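/- Let $\mathbb{K}$ be a field. A duplicial algebra is a $\mathbb{K}$-vector space $A$ with two bilinear operations $\prec,\succ$ satisfying $$(x\prec y)\prec z=x\prec(y\prec z),\qquad (x\succ y)\prec z=x\succ(y\prec z),\qquad (x\succ y)\succ z=x\succ(y\succ z).$$ Let $Dup$ be the corresponding nonsymmetric binary quadratic operad, i.e. the quotient of the free nonsymmetric operad on the two binary operations $\prec,\succ$ by the operadic ideal generated by these three relators. Let $Dup^!$ be its Koszul dual, presented by the dual generators (again written $\prec,\succ$) and by the orthogonal of the relators for the pairing under which the monomials $(x\,e\,y)\,f\,z$ and $x\,e\,(y\,f\,z)$, $e,f\in\{\prec,\succ\}$, form orthogonal families with $\langle m,m\rangle=1$ for $m=(x\,e\,y)\,f\,z$ and $\langle m,m\rangle=-1$ for $m=x\,e\,(y\,f\,z)$. For a duplicial algebra $A$ let $C^{Dup}_n(A)=(Dup^!_n)^*\otimes A^{\otimes n}$ ($n\ge1$) be the operadic chain complex, with differential $$d(f\otimes a_0\cdots a_n)=\sum_{i=0}^{n-1}\ \sum_{e\in\{\prec,\succ\}}(-1)^i f(-\circ_i e)\otimes a_0\cdots (a_i\,e\,a_{i+1})\cdots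 a_n .$$ 1. The operad $Dup$ is a Koszul operad: its Koszul complex, with components $(Dup^!_k)^*\otimes\big(\bigoplus_n Dup_n\big)^{\otimes k}$, $k\ge 1$, is acyclic, i.e. its homology is $Dup_1=\mathbb{K}\,\mathrm{id}$ in degree $k=1$ and $0$ in degrees $k\geq 2$. 2. The space of relators of $Dup^!$ is spanned by the three duplicial relators together with $(x\prec y)\succ z$ and $x\prec(y\succ z)$. Equivalently, the $Dup^!$-algebras are the duplicial algebras satisfying $(x\prec y)\succ z=0=x\prec(y\succ z)$ for all $x,y,z$. 3. For every duplicial algebra $A$, put $C_{pq}(A)=A^{\otimes p+q+1}$ ($p,q\ge0$) and $$d^h(a_0\cdots a_{p+q})=\sum_{i=0}^{p-1}(-1)^i a_0\cdots(a_i\succ a_{i+1})\cdots a_{p+q},\qquad d^v(a_0\cdots a_{p+q})=\sum_{j=p}^{p+q-1}(-1)^j a_0\cdots(a_j\prec a_{j+1})\cdots a_{p+q}.$$ Then $d^hd^h=0$, $d^vd^v=0$, $d^hd^v+d^vd^h=0$, and the maps $C^{Dup}_{n+1}(A)\to\bigoplus_{p+q=n}C_{pq}(A)$, $n\geq 0$,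 whose $(p,q)$-component is $f\otimes a\mapsto f(x\succ\cdots\succ x\prec\cdots\prec x)\,a$ (with $p$ symbols $\succ$ and $q$ symbols $\prec$) are bijective and carry $d$ to $d^h+d^v$. Thus, up to a shift of degree by one, the operadic chain complex of $A$ is the total complex of this bicomplex, whose rows and columns are of Hochschild type. 4. If $A$ is a free duplicial algebra on a vector space $V$, with structure map $\iota:V\to A$, then $H_n(C^{Dup}_*(A))=0$ for $n\ge2$, and $\iota$ induces an isomorphism $V\cong H_1(C^{Dup}_*(A))$. More precisely, there is a linear map $\pi:A\to V$ with $\pi\circ\iota=\mathrm{id}_V$ such that the sequence $\cdots\to C^{Dup}_2(A)\to C^{Dup}_1(A)\to V\to 0$, with last map $f\otimes a\mapsto f(\mathrm{id})\,\pi(a)$, is exact. -/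

import Mathlib

universe u v w

open scoped TensorProduct

noncomputable section

namespace NSKoszul

/-! ### Nonsymmetric operads -/

/-- A nonsymmetric operad in `K`-vector spaces, presented by its partial compositions
`comp i : Op m ⊗ Op n → Op (m + n - 1)` (insertion into the `i`-th input, inputs being numbered
from `0`).  The target arity `k` is recorded by an equation `m + n = k + 1`. -/
structure NSOperad (K : Type u) [Field K] where
  /-- The space of `n`-ary operations. -/
  Op : ℕ → Type v
  [addCommGroup : ∀ n, AddCommGroup (Op n)]
  [module : ∀ n, Module K (Op n)]
  /-- The identity operation. -/
  one : Op 1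
  /-- Partial composition. -/
  comp : ∀ {m n k : ℕ} (_ : Fin m) (_ : m + n = k + 1), Op m →ₗ[K] Op n →ₗ[K] Op k
  one_comp : ∀ {n : ℕ} (h : 1 + n = n + 1) (x : Op n), comp 0 h one x = x
  comp_one : ∀ {m : ℕ} (i : Fin m) (h : m + 1 = m + 1) (x : Op m), comp i h x one = x
  /-- Sequential composition axiom. -/
  comp_assoc : ∀ {l m n a b c : ℕ} (i : Fin l) (j : Fin m) (p : Fin a)
    (_ : (p : ℕ) = i + j) (h₁ : l + m = a + 1) (h₂ : a + n = b + 1)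
    (h₃ : m + n = c + 1) (h₄ : l + c = b + 1) (x : Op l) (y : Op m) (z : Op n),
    comp p h₂ (comp i h₁ x y) z = comp i h₄ x (comp j h₃ y z)
  /-- Parallel composition axiom. -/
  comp_comm : ∀ {l m n a b c : ℕ} (i k : Fin l) (_ : i < k) (p : Fin a) (q : Fin c)
    (_ : (p : ℕ) + 1 = k + m) (_ : (q : ℕ) = i)
    (h₁ : l + m = a + 1) (h₂ : a + n = b + 1)
    (h₃ : l + n = c + 1) (h₄ : c + m = b + 1) (x : Op l) (y : Op m) (z : Op n),
    comp p h₂ (comp i h₁ x y) z = comp q h₄ (comp k h₃ x z) y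

attribute [instance] NSOperad.addCommGroup NSOperad.module

/-! ### Operadic ideals and quotients -/

section Ideal

variable {K : Type u} [Field K] (P : NSOperad.{u, v} K)

/-- Membership in the operadic ideal generated by a family `S` of operations: the smallest family
of subspaces which contains `S` and is stable under composition, on either side, with arbitrary
operations. -/
inductive IdealMem (S : ∀ n, Set (P.Op n)) : ∀ n, P.Op n → Prop
  | of {n : ℕ} (x : P.Op n) (hx : x ∈ S n) : IdealMem S n x
  | zero (n : ℕ) : IdealMem S n 0
  | add {n : ℕ} (x y : P.Op n) (hx : IdealMem S n x) (hy : IdealMem S n y) : IdealMem S n (x + y)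
  | smul {n : ℕ} (c : K) (x : P.Op n) (hx : IdealMem S n x) : IdealMem S n (c • x)
  | comp_left {m n k : ℕ} (i : Fin m) (h : m + n = k + 1) (x : P.Op m) (y : P.Op n)
      (hx : IdealMem S m x) : IdealMem S k (P.comp i h x y)
  | comp_right {m n k : ℕ} (i : Fin m) (h : m + n = k + 1) (x : P.Op m) (y : P.Op n)
      (hy : IdealMem S n y) : IdealMem S k (P.comp i h x y)

/-- The arity `n` part of the operadic ideal generated by `S`. -/
def ideal (S : ∀ n, Set (P.Op n)) (n : ℕ) : Submodule K (P.Op n) where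
  carrier := {x | IdealMem P S n x}
  zero_mem' := IdealMem.zero n
  add_mem' := fun hx hy => IdealMem.add _ _ hx hy
  smul_mem' := fun c _ hx => IdealMem.smul c _ hx

/-- The partial composition induced on the quotient by an operadic ideal. -/
def quotientComp (S : ∀ n, Set (P.Op n)) {m n k : ℕ} (i : Fin m) (h : m + n = k + 1) :
    (P.Op m ⧸ ideal P S m) →ₗ[K] (P.Op n ⧸ ideal P S n) →ₗ[K] (P.Op k ⧸ ideal P S k) :=
  ((ideal P S n).liftQ
    ((ideal P S m).liftQ ((P.comp i h).compr₂ (ideal P S k).mkQ) (by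
      intro x hx
      ext y
      exact (Submodule.Quotient.mk_eq_zero _).2 (IdealMem.comp_left i h x y hx))).flip (by
    intro y hy
    ext x
    exact (Submodule.Quotient.mk_eq_zero _).2 (IdealMem.comp_right i h x y hy))).flip

theorem quotientComp_mk (S : ∀ n, Set (P.Op n)) {m n k : ℕ} (i : Fin m) (h : m + n = k + 1)
    (x : P.Op m) (y : P.Op n) :
    quotientComp P S i h (Submodule.Quotient.mk x) (Submodule.Quotient.mk y) =
      Submodule.Quotient.mk (P.comp i h x y) := rfl

/-- The quotient of a nonsymmetric operad by the operadic ideal generated by `S`. -/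
def quotient (S : ∀ n, Set (P.Op n)) : NSOperad.{u, v} K where
  Op n := P.Op n ⧸ ideal P S n
  one := Submodule.Quotient.mk P.one
  comp i h := quotientComp P S i h
  one_comp h x := by
    induction x using Submodule.Quotient.induction_on with
    | H x => rw [quotientComp_mk, P.one_comp]
  comp_one i h x := by
    induction x using Submodule.Quotient.induction_on with
    | H x => rw [quotientComp_mk, P.comp_one]
  comp_assoc i j p hp h₁ h₂ h₃ h₄ x y z := by
    induction x using Submodule.Quotient.induction_on with
    | H x =>
    induction y using Submodule.Quotient.induction_on with
    | H y =>
    induction z using Submodule.Quotient.induction_on with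
    | H z => simp only [quotientComp_mk, P.comp_assoc i j p hp h₁ h₂ h₃ h₄]
  comp_comm i k hik p q hp hq h₁ h₂ h₃ h₄ x y z := by
    induction x using Submodule.Quotient.induction_on with
    | H x =>
    induction y using Submodule.Quotient.induction_on with
    | H y =>
    induction z using Submodule.Quotient.induction_on with
    | H z => simp only [quotientComp_mk, P.comp_comm i k hik p q hp hq h₁ h₂ h₃ h₄]

end Ideal

/-! ### The free nonsymmetric operad on a set of binary generators -/

/-- Planar binary trees whose internal vertices are labelled by `E`. -/
inductive PTree (E : Type) : Type
  | leaf : PTree E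
  | node (e : E) (l r : PTree E) : PTree E

namespace PTree

variable {E : Type}

/-- The number of leaves. -/
def leaves : PTree E → ℕ
  | leaf => 1
  | node _ l r => l.leaves + r.leaves

/-- `graft t i s` grafts the root of `s` on the `i`-th leaf of `t` (counted from the left, from
`0`; only meaningful for `i < t.leaves`). -/
def graft : PTree E → ℕ → PTree E → PTree E
  | leaf, _, s => s
  | node e l r, i, s =>
    if i < l.leaves then node e (l.graft i s) r else node e l (r.graft (i - l.leaves) s)

theorem leaves_pos (t : PTree E) : 0 < t.leaves := by
  induction t with
  | leaf => simp [leaves]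
  | node e l r hl hr => simp only [leaves]; omega

theorem leaves_graft (t s : PTree E) (i : ℕ) (hi : i < t.leaves) :
    (t.graft i s).leaves + 1 = t.leaves + s.leaves := by
  induction t generalizing i with
  | leaf => simp only [graft, leaves]; omega
  | node e l r hl hr =>
    simp only [graft, leaves] at hi ⊢
    split_ifs with h
    · have := hl i h
      simp only [leaves]; omega
    · have := hr (i - l.leaves) (by omega)
      simp only [leaves]; omega

theorem graft_leaf (t : PTree E) (i : ℕ) : t.graft i leaf = t := by
  induction t generalizing i with
  | leaf => rfl
  | node e l r hl hr => simp only [graft, hl, hr, ite_self]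

theorem graft_assoc (t s r : PTree E) (i j : ℕ) (hi : i < t.leaves) (hj : j < s.leaves) :
    (t.graft i s).graft (i + j) r = t.graft i (s.graft j r) := by
  induction t generalizing i with
  | leaf =>
    have : i = 0 := by simp only [leaves] at hi; omega
    subst this
    simp [graft]
  | node e a b ha hb =>
    simp only [leaves] at hi
    by_cases h : i < a.leaves
    · have h1 := leaves_graft a s i h
      have h2 : i + j < (a.graft i s).leaves := by omega
      simp only [graft, h, if_true, h2, ha i h]
    · have h2 : ¬ (i + j < a.leaves) := by omega
      have h3 : i + j - a.leaves = (i - a.leaves) + j := by omega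
      simp only [graft, h, if_false, h2, h3, hb (i - a.leaves) (by omega)]

theorem graft_comm (t s r : PTree E) (i k p : ℕ) (hik : i < k) (hk : k < t.leaves)
    (hp : p + 1 = k + s.leaves) :
    (t.graft i s).graft p r = (t.graft k r).graft i s := by
  induction t generalizing i k p with
  | leaf => simp only [leaves] at hk; omega
  | node e a b ha hb =>
    simp only [leaves] at hk
    have hs := leaves_pos s
    by_cases h : i < a.leaves
    · have h1 := leaves_graft a s i h
      by_cases h' : k < a.leaves
      · have h2 := leaves_graft a r k h'
        have hr := leaves_pos r
        have h3 : p < (a.graft i s).leaves := by omega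
        have h4 : i < (a.graft k r).leaves := by omega
        simp only [graft, h, h', if_true, h3, h4, ha i k p hik h' hp]
      · have h3 : ¬ (p < (a.graft i s).leaves) := by omega
        have h4 : p - (a.graft i s).leaves = k - a.leaves := by omega
        simp only [graft, h, h', if_true, if_false, h3, h4]
    · have h' : ¬ (k < a.leaves) := by omega
      have h3 : ¬ (p < a.leaves) := by omega
      simp only [graft, h, h', if_false, h3,
        hb (i - a.leaves) (k - a.leaves) (p - a.leaves) (by omega) (by omega) (by omega)]

/-- The sign of a tree with three leaves: `+1` for `(x y) z` and `-1` for `x (y z)`. -/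
def sign : PTree E → ℤ
  | node _ (node _ _ _) _ => 1
  | _ => -1

/-- The value of a tree at the inputs `a 0, a 1, ...` when each label is interpreted as a binary
operation. -/
def eval {A : Type w} (op : E → A → A → A) : PTree E → (ℕ → A) → A
  | leaf, a => a 0
  | node e l r, a => op e (l.eval op a) (r.eval op fun j => a (l.leaves + j))

end PTree

section Free

variable (K : Type u) [Field K] (E : Type)

/-- The vector space with basis the `E`-labelled planar binary trees with `n` leaves. -/
abbrev TreeModule (n : ℕ) : Type u := {t : PTree E // t.leaves = n} →₀ K

variable {E}

/-- Grafting, with control of the number of leaves. -/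
def graftArity {m n k : ℕ} (i : Fin m) (h : m + n = k + 1) (t : {t : PTree E // t.leaves = m})
    (s : {t : PTree E // t.leaves = n}) : {t : PTree E // t.leaves = k} :=
  ⟨t.1.graft i s.1, by
    have := PTree.leaves_graft t.1 s.1 i (by rw [t.2]; exact i.2)
    rw [t.2, s.2] at this
    omega⟩

/-- The bilinear extension of grafting. -/
def treeComp {m n k : ℕ} (i : Fin m) (h : m + n = k + 1) :
    TreeModule K E m →ₗ[K] TreeModule K E n →ₗ[K] TreeModule K E k :=
  Finsupp.linearCombination K fun t => Finsupp.lmapDomain K K (graftArity i h t)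

theorem treeComp_single {m n k : ℕ} (i : Fin m) (h : m + n = k + 1)
    (t : {t : PTree E // t.leaves = m}) (s : {t : PTree E // t.leaves = n}) (a b : K) :
    treeComp K i h (Finsupp.single t a) (Finsupp.single s b) =
      Finsupp.single (graftArity i h t s) (a * b) := by
  simp [treeComp]

variable (E)

/-- The free nonsymmetric operad on a set `E` of binary operations. -/
def freeOperad : NSOperad.{u, u} K where
  Op n := TreeModule K E n
  one := Finsupp.single ⟨PTree.leaf, rfl⟩ 1
  comp i h := treeComp K i h
  one_comp h x := by
    induction x using Finsupp.induction_linear with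
    | zero => simp
    | add x y hx hy => simp only [map_add, hx, hy]
    | single t a =>
      rw [treeComp_single, one_mul]
      rfl
  comp_one i h x := by
    induction x using Finsupp.induction_linear with
    | zero => simp
    | add x y hx hy => simp only [map_add, LinearMap.add_apply, hx, hy]
    | single t a =>
      rw [treeComp_single, mul_one]
      congr 1
      exact Subtype.ext (PTree.graft_leaf _ _)
  comp_assoc i j p hp h₁ h₂ h₃ h₄ x y z := by
    induction x using Finsupp.induction_linear with
    | zero => simp
    | add x x' hx hx' => simp only [map_add, LinearMap.add_apply, hx, hx']
    | single t a =>
    induction y using Finsupp.induction_linear with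
    | zero => simp
    | add y y' hy hy' => simp only [map_add, LinearMap.add_apply, hy, hy']
    | single s b =>
    induction z using Finsupp.induction_linear with
    | zero => simp
    | add z z' hz hz' => simp only [map_add, hz, hz']
    | single r c =>
      simp only [treeComp_single, mul_assoc]
      congr 1
      apply Subtype.ext
      simp only [graftArity, hp]
      exact PTree.graft_assoc _ _ _ _ _ (by rw [t.2]; exact i.2) (by rw [s.2]; exact j.2)
  comp_comm i k hik p q hp hq h₁ h₂ h₃ h₄ x y z := by
    induction x using Finsupp.induction_linear with
    | zero => simp
    | add x x' hx hx' => simp only [map_add, LinearMap.add_apply, hx, hx']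
    | single t a =>
    induction y using Finsupp.induction_linear with
    | zero => simp
    | add y y' hy hy' => simp only [map_add, LinearMap.add_apply, hy, hy']
    | single s b =>
    induction z using Finsupp.induction_linear with
    | zero => simp
    | add z z' hz hz' => simp only [map_add, LinearMap.add_apply, hz, hz']
    | single r c =>
      simp only [treeComp_single, mul_right_comm a b c]
      congr 1
      apply Subtype.ext
      simp only [graftArity, hq]
      exact PTree.graft_comm _ _ _ _ _ _ hik (by rw [t.2]; exact k.2) (by rw [s.2]; exact hp)

end Free

/-! ### Binary quadratic operads and their Koszul duals -/

section Quadratic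

variable {K : Type u} [Field K] {E : Type}

/-- The family of operations consisting of the relators `R` in arity `3`. -/
def relators (R : Submodule K (TreeModule K E 3)) : ∀ n, Set ((freeOperad K E).Op n)
  | 3 => (R : Set (TreeModule K E 3))
  | _ => ∅

/-- The binary quadratic operad with generating operations `E` and space of relators `R`: the
quotient of the free operad on `E` by the operadic ideal generated by `R`. -/
def quadraticOperad (R : Submodule K (TreeModule K E 3)) : NSOperad.{u, u} K :=
  quotient (freeOperad K E) (relators R)

/-- The class of a tree in a quadratic operad. -/
def treeClass (R : Submodule K (TreeModule K E 3)) {n : ℕ} (t : PTree E) (h : t.leaves = n) :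
    (quadraticOperad R).Op n :=
  (ideal (freeOperad K E) (relators R) n).mkQ
    (Finsupp.single (⟨t, h⟩ : {t : PTree E // t.leaves = n}) (1 : K) : TreeModule K E n)

/-- The generating operation labelled by `e`. -/
def generator (R : Submodule K (TreeModule K E 3)) (e : E) : (quadraticOperad R).Op 2 :=
  treeClass R (PTree.node e PTree.leaf PTree.leaf) rfl

/-- The orthogonal `R^⊥` of the space of relators, for the pairing between the arity `3` parts of
the free operads on the generators and on the dual generators: the trees form orthogonal bases,
`⟨(x y) z, (x y) z⟩ = 1` and `⟨x (y z), x (y z)⟩ = -1` when the labels agree.  The basis dual to the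
generators is indexed by `E` again. -/
def orthogonal (R : Submodule K (TreeModule K E 3)) : Submodule K (TreeModule K E 3) :=
  ⨅ r ∈ R, LinearMap.ker
    (Finsupp.linearCombination K fun t : {t : PTree E // t.leaves = 3} => (t.1.sign : K) * r t)

/-- The Koszul dual operad `P^!` of the quadratic operad `P` given by `R`. -/
def koszulDual (R : Submodule K (TreeModule K E 3)) : NSOperad.{u, u} K :=
  quadraticOperad (orthogonal R)

/-- `(A, op)` is an algebra of the type defined by the generating operations `E` and the
relators `R`: every relator vanishes identically on `A`. -/
def IsAlgebraOfType (R : Submodule K (TreeModule K E 3)) {A : Type w} [AddCommGroup A]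
    [Module K A] (op : E → A →ₗ[K] A →ₗ[K] A) : Prop :=
  ∀ r ∈ R, ∀ a : ℕ → A,
    (Finsupp.linearCombination K fun t : {t : PTree E // t.leaves = 3} =>
      t.1.eval (fun e x y => op e x y) a) r = 0

end Quadratic

/-! ### The operadic chain complex of an algebra -/

section Tensor

variable {K : Type u} [Field K] {A : Type w} [AddCommGroup A] [Module K A]

/-- Contracting a family in which one entry is replaced by `x` replaces one entry of the contracted
family by a linear function of `x`. -/
theorem contract_update (μ : A →ₗ[K] A →ₗ[K] A) {m k : ℕ} (h : m = k + 1)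
    (i : Fin k) (inst : DecidableEq (Fin m)) (a : Fin m → A) (j : Fin m) :
    ∃ (t : Fin k) (φ : A →ₗ[K] A), ∀ x : A,
      (Fin.contractNth i.castSucc (fun x y => μ x y) fun l =>
        (@Function.update _ _ inst a j x) (Fin.cast h.symm l)) =
      Function.update (Fin.contractNth i.castSucc (fun x y => μ x y) fun l =>
        a (Fin.cast h.symm l)) t (φ x) := by
  subst h
  obtain rfl : inst = instDecidableEqFin _ := Subsingleton.elim _ _
  have hi := i.2
  have hj := j.2
  rcases lt_trichotomy (j : ℕ) i with hji | hji | hji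
  · refine ⟨⟨j, by omega⟩, LinearMap.id, fun x => funext fun l => ?_⟩
    simp only [Fin.contractNth, Function.update_apply, Fin.ext_iff, Fin.val_cast, Fin.val_castSucc,
      Fin.val_succ, LinearMap.id_apply]
    grind
  · refine ⟨i, μ.flip (a i.succ), fun x => funext fun l => ?_⟩
    simp only [Fin.contractNth, Function.update_apply, Fin.ext_iff, Fin.val_cast, Fin.val_castSucc,
      Fin.val_succ, LinearMap.flip_apply]
    have : l = i ∨ (l : ℕ) ≠ i := by rw [Fin.ext_iff]; tauto
    rcases this with rfl | hl
    · simp [hji]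
    · grind
  · by_cases hj' : (j : ℕ) = i + 1
    · refine ⟨i, μ (a i.castSucc), fun x => funext fun l => ?_⟩
      simp only [Fin.contractNth, Function.update_apply, Fin.ext_iff, Fin.val_cast,
        Fin.val_castSucc, Fin.val_succ]
      have : l = i ∨ (l : ℕ) ≠ i := by rw [Fin.ext_iff]; tauto
      rcases this with rfl | hl
      · simp [hj']
      · grind
    · refine ⟨⟨j - 1, by omega⟩, LinearMap.id, fun x => funext fun l => ?_⟩
      simp only [Fin.contractNth, Function.update_apply, Fin.ext_iff, Fin.val_cast,
        Fin.val_castSucc, Fin.val_succ, LinearMap.id_apply]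
      grind

/-- The multilinear map `(a_0, ..., a_k) ↦ a_0 ⊗ ⋯ ⊗ μ(a_i, a_{i+1}) ⊗ ⋯ ⊗ a_k`, where the number
of inputs is `m = k + 1`. -/
def faceMultilinear (μ : A →ₗ[K] A →ₗ[K] A) {m k : ℕ} (h : m = k + 1) (i : Fin k) :
    MultilinearMap K (fun _ : Fin m => A) (⨂[K] _ : Fin k, A) where
  toFun a := PiTensorProduct.tprod K
    (Fin.contractNth i.castSucc (fun x y => μ x y) fun j => a (Fin.cast h.symm j))
  map_update_add' := by
    intro inst a j x y
    obtain ⟨t, φ, hφ⟩ := contract_update μ h i inst a j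
    rw [hφ, hφ, hφ, map_add, MultilinearMap.map_update_add]
  map_update_smul' := by
    intro inst a j c x
    obtain ⟨t, φ, hφ⟩ := contract_update μ h i inst a j
    rw [hφ, hφ, map_smul, MultilinearMap.map_update_smul]

/-- The map `a_0 ⊗ ⋯ ⊗ a_k ↦ a_0 ⊗ ⋯ ⊗ μ(a_i, a_{i+1}) ⊗ ⋯ ⊗ a_k` on tensor powers. -/
def face (μ : A →ₗ[K] A →ₗ[K] A) {m k : ℕ} (h : m = k + 1) (i : Fin k) :
    (⨂[K] _ : Fin m, A) →ₗ[K] (⨂[K] _ : Fin k, A) :=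
  PiTensorProduct.lift (faceMultilinear μ h i)

end Tensor

section Complex

variable {K : Type u} [Field K] {E : Type} (R : Submodule K (TreeModule K E 3))

/-- The space `C_n(A) = (P^!_n)^* ⊗ A^{⊗ n}` of operadic chains. -/
abbrev Chains (A : Type w) [AddCommGroup A] [Module K A] (n : ℕ) : Type (max u w) :=
  Module.Dual K ((koszulDual R).Op n) ⊗[K] (⨂[K] _ : Fin n, A)

/-- The operation `y ↦ y ∘_i e^∨` from `P^!_n` to `P^!_{n+1}`. -/
def insertGenerator (e : E) {n : ℕ} (i : Fin n) :
    (koszulDual R).Op n →ₗ[K] (koszulDual R).Op (n + 1) :=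
  ((koszulDual R).comp i (rfl : n + 2 = (n + 1) + 1)).flip (generator (orthogonal R) e)

/-- The map `C_1(A) = (P^!_1)^* ⊗ A → V`, `f ⊗ a ↦ f(id) π(a)` induced by `π : A → V`. -/
def augmentation {A : Type w} [AddCommGroup A] [Module K A]
    {V : Type v} [AddCommGroup V] [Module K V] (π : A →ₗ[K] V) :
    Chains R A 1 →ₗ[K] V :=
  (TensorProduct.lid K V).toLinearMap ∘ₗ
    TensorProduct.map (Module.Dual.eval K _ (koszulDual R).one)
      (π ∘ₗ (PiTensorProduct.subsingletonEquiv (0 : Fin 1)).toLinearMap)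

variable [Fintype E] {A : Type w} [AddCommGroup A] [Module K A]

/-- The operadic differential `C_{n+1}(A) → C_n(A)`,
`d (f ⊗ a_0 ⋯ a_n) = ∑_i ∑_e (-1)^i f(- ∘_i e^∨) ⊗ a_0 ⋯ e(a_i, a_{i+1}) ⋯ a_n`.
The maps `f ↦ f(- ∘_i e^∨)` are the components of the infinitesimal decomposition of the cooperad
dual to `P^!` along the cogenerators, so that this is the coderivation extending the products
of `A`. -/
def differential (op : E → A →ₗ[K] A →ₗ[K] A) (n : ℕ) : Chains R A (n + 1) →ₗ[K] Chains R A n :=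
  ∑ i : Fin n, ∑ e : E, (-1 : K) ^ (i : ℕ) •
    TensorProduct.map (insertGenerator R e i).dualMap (face (op e) rfl i)

/-- The operadic homology of `(A, op)` vanishes in degrees `≥ 2`, and it is identified with `V` in
degree `1` by means of `π : A → V`: the augmented complex
`⋯ → C_3(A) → C_2(A) → C_1(A) → V → 0` is exact. -/
structure IsAcyclic (op : E → A →ₗ[K] A →ₗ[K] A) {V : Type v} [AddCommGroup V] [Module K V]
    (π : A →ₗ[K] V) : Prop where
  exact_of_pos : ∀ n : ℕ, 1 ≤ n → Function.Exact (differential R op (n + 1)) (differential R op n)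
  exact_one : Function.Exact (differential R op 1) (augmentation R π)
  surjective : Function.Surjective (augmentation R π)

end Complex

/-! ### The Koszul complex and Koszul operads -/

section Koszul

variable {K : Type u} [Field K] {E : Type} (R : Submodule K (TreeModule K E 3))

/-- The sum of all the spaces of operations of a quadratic operad `P`, that is, the free
`P`-algebra on one generator. -/
abbrev TotalSpace : Type u := DirectSum ℕ fun n => (quadraticOperad R).Op n

/-- The product `(x, y) ↦ e ∘ (x, y)`, from `P_m ⊗ P_n` to `P_{m+n}`. -/
def gradedProduct (e : E) (m n : ℕ) :
    (quadraticOperad R).Op m →ₗ[K] (quadraticOperad R).Op n →ₗ[K] (quadraticOperad R).Op (m + n) :=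
  (((quadraticOperad R).comp (0 : Fin (n + 1)) (by omega : (n + 1) + m = (m + n) + 1)) ∘ₗ
    ((quadraticOperad R).comp (1 : Fin 2) (by omega : 2 + n = (n + 1) + 1)
      (generator R e))).flip

/-- The product `(x, y) ↦ e ∘ (x, y)` on the sum of all the spaces of operations. -/
def totalProduct (e : E) : TotalSpace R →ₗ[K] TotalSpace R →ₗ[K] TotalSpace R :=
  DirectSum.toModule K ℕ _ fun m =>
    (DirectSum.toModule K ℕ _ fun n =>
      ((gradedProduct R e m n).compr₂ (DirectSum.lof K ℕ _ (m + n))).flip).flip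

/-- The binary quadratic operad `P` is a Koszul operad: its Koszul complex `P^¡ ∘ P`, whose
component of weight `k` (summed over all arities) is `(P^!_k)^* ⊗ (⨁_n P_n)^{⊗ k}`, is acyclic, that
is, the augmentation onto `P_1 = K id` is a quasi-isomorphism. -/
def IsKoszul [Fintype E] : Prop :=
  IsAcyclic R (totalProduct R) (DirectSum.component K ℕ (fun n => (quadraticOperad R).Op n) 1)

end Koszul

/-! ### Duplicial algebras -/

/-- A duplicial algebra structure on a vector space: two bilinear operations `x ≺ y` (`left`) and
`x ≻ y` (`right`) satisfying three relations. -/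
structure DuplicialAlgebra (K : Type u) [Field K] (A : Type w) [AddCommGroup A] [Module K A] where
  left : A →ₗ[K] A →ₗ[K] A
  right : A →ₗ[K] A →ₗ[K] A
  left_left : ∀ x y z, left (left x y) z = left x (left y z)
  right_left : ∀ x y z, left (right x y) z = right x (left y z)
  right_right : ∀ x y z, right (right x y) z = right x (right y z)

/-- The two generating operations of the operad of duplicial algebras. -/
inductive DupGen : Type
  | left : DupGen
  | right : DupGen
  deriving DecidableEq

instance : Fintype DupGen where
  elems := {DupGen.left, DupGen.right}
  complete := fun e => by cases e <;> simp

/-- The two operations of a duplicial algebra, indexed by the generators. -/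
def DuplicialAlgebra.op {K : Type u} [Field K] {A : Type w} [AddCommGroup A] [Module K A]
    (D : DuplicialAlgebra K A) : DupGen → A →ₗ[K] A →ₗ[K] A
  | DupGen.left => D.left
  | DupGen.right => D.right

section Dup

variable (K : Type u) [Field K]

/-- The operation `(x, y, z) ↦ (x f y) e z` of the free operad. -/
def leftComb {E : Type} (e f : E) : TreeModule K E 3 :=
  Finsupp.single ⟨PTree.node e (PTree.node f PTree.leaf PTree.leaf) PTree.leaf, rfl⟩ 1

/-- The operation `(x, y, z) ↦ x e (y f z)` of the free operad. -/
def rightComb {E : Type} (e f : E) : TreeModule K E 3 :=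
  Finsupp.single ⟨PTree.node e PTree.leaf (PTree.node f PTree.leaf PTree.leaf), rfl⟩ 1

/-- The relators of the operad `Dup`:
`(x ≺ y) ≺ z - x ≺ (y ≺ z)`, `(x ≻ y) ≺ z - x ≻ (y ≺ z)` and `(x ≻ y) ≻ z - x ≻ (y ≻ z)`. -/
def dupRelators : Submodule K (TreeModule K DupGen 3) :=
  Submodule.span K
    {leftComb K DupGen.left DupGen.left - rightComb K DupGen.left DupGen.left,
     leftComb K DupGen.left DupGen.right - rightComb K DupGen.right DupGen.left,
     leftComb K DupGen.right DupGen.right - rightComb K DupGen.right DupGen.right}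

/-- The additional relators `(x ≺ y) ≻ z` and `x ≺ (y ≻ z)`. -/
def dupExtraRelators : Submodule K (TreeModule K DupGen 3) :=
  Submodule.span K
    {leftComb K DupGen.right DupGen.left, rightComb K DupGen.left DupGen.right}

end Dup

/-- A linear map is a morphism of duplicial algebras. -/
def IsDuplicialHom {K : Type u} [Field K] {A : Type v} {B : Type w} [AddCommGroup A] [Module K A]
    [AddCommGroup B] [Module K B] (D : DuplicialAlgebra K A) (D' : DuplicialAlgebra K B)
    (g : A →ₗ[K] B) : Prop :=
  (∀ x y, g (D.left x y) = D'.left (g x) (g y)) ∧ ∀ x y, g (D.right x y) = D'.right (g x) (g y)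

/-- The duplicial algebra `A` is free over the vector space `V`, by means of `ι : V → A`. -/
def IsFreeDuplicial {K : Type u} [Field K] {V : Type v} [AddCommGroup V] [Module K V]
    {A : Type (max u v)} [AddCommGroup A] [Module K A] (D : DuplicialAlgebra K A)
    (ι : V →ₗ[K] A) : Prop :=
  ∀ (B : Type (max u v)) [AddCommGroup B] [Module K B] (D' : DuplicialAlgebra K B)
    (f : V →ₗ[K] B), ∃! g : A →ₗ[K] B, IsDuplicialHom D D' g ∧ g ∘ₗ ι = f

/-! ### The bicomplex of a duplicial algebra -/

section Bicomplex

variable {K : Type u} [Field K] {A : Type w} [AddCommGroup A] [Module K A]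

variable (K A) in
/-- The term `C_{pq}(A) = A^{⊗ p+q+1}` of the bicomplex. -/
abbrev Bi (p q : ℕ) : Type (max u w) := ⨂[K] _ : Fin (p + q + 1), A

/-- The horizontal differential `C_{p+1,q}(A) → C_{p,q}(A)`,
`a_0 ⋯ a_{p+q+1} ↦ ∑_{0 ≤ i ≤ p} (-1)^i a_0 ⋯ (a_i ≻ a_{i+1}) ⋯ a_{p+q+1}`. -/
def dHor (D : DuplicialAlgebra K A) (p q : ℕ) : Bi K A (p + 1) q →ₗ[K] Bi K A p q :=
  ∑ i : Fin (p + 1), (-1 : K) ^ (i : ℕ) •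
    face D.right (by omega : p + 1 + q + 1 = p + q + 1 + 1) ⟨i, by omega⟩

/-- The vertical differential `C_{p,q+1}(A) → C_{p,q}(A)`,
`a_0 ⋯ a_{p+q+1} ↦ ∑_{p ≤ j ≤ p+q} (-1)^j a_0 ⋯ (a_j ≺ a_{j+1}) ⋯ a_{p+q+1}`. -/
def dVer (D : DuplicialAlgebra K A) (p q : ℕ) : Bi K A p (q + 1) →ₗ[K] Bi K A p q :=
  ∑ j : Fin (q + 1), (-1 : K) ^ (p + j : ℕ) •
    face D.left (by omega : p + (q + 1) + 1 = p + q + 1 + 1) ⟨p + j, by omega⟩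

variable (K A) in
/-- The term `⨁_{p+q=n} C_{pq}(A)` of the total complex. -/
abbrev Tot (n : ℕ) : Type (max u w) := ∀ s : {s : ℕ × ℕ // s.1 + s.2 = n}, Bi K A s.1.1 s.1.2

/-- The differential `d^h + d^v` of the total complex. -/
def dTot (D : DuplicialAlgebra K A) (n : ℕ) : Tot K A (n + 1) →ₗ[K] Tot K A n :=
  LinearMap.pi fun s =>
    dHor D s.1.1 s.1.2 ∘ₗ LinearMap.proj (R := K)
      (φ := fun s : {s : ℕ × ℕ // s.1 + s.2 = n + 1} => Bi K A s.1.1 s.1.2)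
      ⟨(s.1.1 + 1, s.1.2), by have := s.2; simp only; omega⟩ +
    dVer D s.1.1 s.1.2 ∘ₗ LinearMap.proj (R := K)
      (φ := fun s : {s : ℕ × ℕ // s.1 + s.2 = n + 1} => Bi K A s.1.1 s.1.2)
      ⟨(s.1.1, s.1.2 + 1), by have := s.2; simp only; omega⟩

/-- The monomial `x ≻ (x ≻ ⋯ (x ≻ ((x ≺ x) ≺ ⋯ ≺ x)))`, with `p` operations `≻` and `q`
operations `≺`. -/
def dupMonomial : ℕ → ℕ → PTree DupGen
  | 0, 0 => PTree.leaf
  | 0, q + 1 => PTree.node DupGen.left (dupMonomial 0 q) PTree.leaf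
  | p + 1, q => PTree.node DupGen.right PTree.leaf (dupMonomial p q)

theorem leaves_dupMonomial (p q : ℕ) : (dupMonomial p q).leaves = p + q + 1 := by
  induction p with
  | zero =>
    induction q with
    | zero => simp [dupMonomial, PTree.leaves]
    | succ q ih => simp only [dupMonomial, PTree.leaves, ih]; omega
  | succ p ih => simp only [dupMonomial, PTree.leaves, ih]; omega

/-- The map from the operadic chains of `A` of degree `n + 1` to the total complex of degree `n`
whose component of bidegree `(p, q)` is
`f ⊗ a ↦ f(x ≻ ⋯ ≻ x ≺ ⋯ ≺ x) a`, with `p` operations `≻` and `q` operations `≺`. -/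
def toTot (n : ℕ) : Chains (dupRelators K) A (n + 1) →ₗ[K] Tot K A n :=
  LinearMap.pi fun s =>
    (TensorProduct.lid K (Bi K A s.1.1 s.1.2)).toLinearMap ∘ₗ
      TensorProduct.map
        (Module.Dual.eval K _ (treeClass (orthogonal (dupRelators K)) (dupMonomial s.1.1 s.1.2)
          ((leaves_dupMonomial _ _).trans (by rw [s.2]))))
        (PiTensorProduct.reindex K (fun _ : Fin (n + 1) => A)
          (finCongr (by rw [s.2]))).toLinearMap

end Bicomplex

end NSKoszul

end

/-!
Modulo the relators of `Dup^!` every monomial is zero or of the form `x ≻ ⋯ ≻ x ≺ ⋯ ≺ x`, and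
these are linearly independent because they become the monomials `s ^ p * t ^ q` in a suitable
`Dup^!`-algebra of polynomials. The dual basis turns the operadic chain complex into the total
complex of the bicomplex.

For a free algebra `A` on `V` there are maps `σ, θ : A → A ⊗ A` and `π : A → V` such that every
`x : A` is the sum of the images of `σ x` under `≻` and of `θ x` under `≺` and of `ι (π x)`.
Freeness provides `σ` and `θ` as the second components of morphisms from `A` to extensions of `A`
by `A ⊗ A`. Applying `σ` to the factor between the operations of the two types, and also `θ` to
the first factor in the column `p = 0`, contracts the total complex. Finally, the operations of
`Dup` form the free algebra on one generator, so that Koszulness is a special case.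
-/

noncomputable section

namespace NSKoszul

/-! ### Evaluation of operations in algebras -/

namespace PTree

variable {E : Type} {A : Type w}

theorem eval_congr (op : E → A → A → A) (t : PTree E) {a b : ℕ → A}
    (h : ∀ j < t.leaves, a j = b j) : t.eval op a = t.eval op b := by
  induction t generalizing a b with
  | leaf => exact h 0 leaf.leaves_pos
  | node e l r hl hr =>
    simp only [leaves] at h
    simp only [eval]
    rw [hl fun j hj => h j (by omega), hr fun j hj => h (l.leaves + j) (by omega)]

/-- The inputs obtained from `a` when the `n ≥ 1` consecutive inputs starting at `a i` are replaced
by the single input `x`. -/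
def contractInputs (a : ℕ → A) (i n : ℕ) (x : A) : ℕ → A :=
  Function.update (fun j => if j < i then a j else a (j + n - 1)) i x

theorem contractInputs_of_lt (a : ℕ → A) {i j : ℕ} (h : j < i) (n : ℕ) (x : A) :
    contractInputs a i n x j = a j := by
  rw [contractInputs, Function.update_of_ne h.ne, if_pos h]

theorem contractInputs_of_gt (a : ℕ → A) {i j : ℕ} (h : i < j) (n : ℕ) (x : A) :
    contractInputs a i n x j = a (j + n - 1) := by
  rw [contractInputs, Function.update_of_ne h.ne', if_neg h.not_gt]

theorem contractInputs_add_left (a : ℕ → A) (l i n : ℕ) (hn : 0 < n) (x : A) (j : ℕ) :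
    contractInputs a (l + i) n x (l + j) = contractInputs (fun j => a (l + j)) i n x j := by
  simp only [contractInputs, Function.update_apply, Nat.add_left_cancel_iff,
    Nat.add_lt_add_iff_left]
  rw [show l + j + n - 1 = l + (j + n - 1) by omega]

theorem eval_graft (op : E → A → A → A) (t s : PTree E) {i : ℕ} (hi : i < t.leaves) (a : ℕ → A) :
    (t.graft i s).eval op a =
      t.eval op (contractInputs a i s.leaves (s.eval op fun l => a (i + l))) := by
  induction t generalizing i a with
  | leaf =>
    obtain rfl : i = 0 := by simp only [leaves] at hi; omega
    simp [graft, eval, contractInputs]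
  | node e l r hl hr =>
    by_cases h : i < l.leaves
    · have hg := leaves_graft l s i h
      simp only [graft, h, if_true, eval, hl h]
      congr 2
      funext j
      rw [contractInputs_of_gt a (by omega)]
      congr 1
      omega
    · obtain ⟨k, rfl⟩ := Nat.exists_eq_add_of_le (not_lt.1 h)
      simp only [leaves, Nat.add_lt_add_iff_left] at hi
      simp only [graft, h, if_false, eval, Nat.add_sub_cancel_left, hr hi,
        contractInputs_add_left a _ _ _ s.leaves_pos, Nat.add_assoc]
      congr 1
      exact eval_congr op l fun j hj => (contractInputs_of_lt a (by omega) _ _).symm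

end PTree

section Evaluation

variable {K : Type u} [Field K] {E : Type} {A : Type w} [AddCommGroup A] [Module K A]
  (op : E → A →ₗ[K] A →ₗ[K] A)

theorem PTree.exists_linearMap_eval_update (t : PTree E) {i : ℕ} (hi : i < t.leaves) (a : ℕ → A) :
    ∃ φ : A →ₗ[K] A, ∀ x,
      t.eval (fun e x y => op e x y) (Function.update a i x) = φ x := by
  induction t generalizing i a with
  | leaf =>
    obtain rfl : i = 0 := by simp only [leaves] at hi; omega
    exact ⟨LinearMap.id, fun x => by simp [eval]⟩
  | node e l r hl hr =>
    by_cases h : i < l.leaves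
    · obtain ⟨φ, hφ⟩ := hl h a
      refine ⟨(op e).flip (r.eval (fun e x y => op e x y) fun j => a (l.leaves + j)) ∘ₗ φ,
        fun x => ?_⟩
      have hr' : ∀ j, Function.update a i x (l.leaves + j) = a (l.leaves + j) := fun j =>
        Function.update_of_ne (by omega) _ _
      simp only [eval, hφ, hr', LinearMap.comp_apply, LinearMap.flip_apply]
    · obtain ⟨k, rfl⟩ := Nat.exists_eq_add_of_le (not_lt.1 h)
      obtain ⟨φ, hφ⟩ := hr (Nat.add_lt_add_iff_left.1 hi) fun j => a (l.leaves + j)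
      refine ⟨op e (l.eval (fun e x y => op e x y) a) ∘ₗ φ, fun x => ?_⟩
      have hl' : l.eval (fun e x y => op e x y) (Function.update a (l.leaves + k) x) =
          l.eval (fun e x y => op e x y) a :=
        eval_congr _ l fun j hj => Function.update_of_ne (by omega) _ _
      have hr' : (fun j => Function.update a (l.leaves + k) x (l.leaves + j)) =
          Function.update (fun j => a (l.leaves + j)) k x := by
        funext j
        simp only [Function.update_apply, Nat.add_left_cancel_iff]
      simp only [eval, hl', hr', hφ, LinearMap.comp_apply]

/-- The value at the inputs `a 0, a 1, ...` of an operation of the free operad. -/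
def evalTree (a : ℕ → A) (n : ℕ) : TreeModule K E n →ₗ[K] A :=
  Finsupp.linearCombination K fun t => t.1.eval (fun e x y => op e x y) a

theorem evalTree_single (a : ℕ → A) (n : ℕ) (t : {t : PTree E // t.leaves = n}) (c : K) :
    evalTree op a n (Finsupp.single t c) = c • t.1.eval (fun e x y => op e x y) a :=
  Finsupp.linearCombination_single ..

theorem exists_linearMap_evalTree_update {n i : ℕ} (hi : i < n) (x : TreeModule K E n)
    (a : ℕ → A) : ∃ φ : A →ₗ[K] A, ∀ b, evalTree op (Function.update a i b) n x = φ b := by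
  choose φ hφ using fun t : {t : PTree E // t.leaves = n} =>
    t.1.exists_linearMap_eval_update op (hi.trans_eq t.2.symm) a
  refine ⟨Finsupp.linearCombination K φ x, fun b => ?_⟩
  simp only [evalTree, hφ, Finsupp.linearCombination_apply, Finsupp.sum, LinearMap.sum_apply,
    LinearMap.smul_apply]

variable {op}

theorem evalTree_eq_zero_of_span_eq_top {S : Set A} (hS : Submodule.span K S = ⊤) {n : ℕ}
    {x : TreeModule K E n} (h : ∀ a : ℕ → A, (∀ j < n, a j ∈ S) → evalTree op a n x = 0)
    (a : ℕ → A) : evalTree op a n x = 0 := by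
  suffices key : ∀ m ≤ n, ∀ a : ℕ → A, (∀ j < n, m ≤ j → a j ∈ S) → evalTree op a n x = 0 from
    key n le_rfl a fun j hj hnj => absurd hj hnj.not_gt
  intro m hm
  induction m with
  | zero => exact fun a ha => h a fun j hj => ha j hj (Nat.zero_le j)
  | succ m ih =>
    intro a ha
    obtain ⟨φ, hφ⟩ := exists_linearMap_evalTree_update op hm x a
    have hSφ : S ⊆ LinearMap.ker φ := fun b hb => by
      refine LinearMap.mem_ker.2 ((hφ b).symm.trans (ih (by omega) _ fun j hj hmj => ?_))
      rcases hmj.eq_or_lt with rfl | hmj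
      · rwa [Function.update_self]
      · rw [Function.update_of_ne hmj.ne']
        exact ha j hj hmj
    have hφ0 : a m ∈ LinearMap.ker φ := Submodule.span_le.2 hSφ (hS ▸ Submodule.mem_top)
    rwa [LinearMap.mem_ker, ← hφ, Function.update_eq_self] at hφ0

theorem evalTree_treeComp_eq_zero_of_left {m n k : ℕ} (i : Fin m) (h : m + n = k + 1)
    {x : TreeModule K E m} (hx : ∀ a : ℕ → A, evalTree op a m x = 0) (y : TreeModule K E n)
    (a : ℕ → A) : evalTree op a k (treeComp K i h x y) = 0 := by
  induction y using Finsupp.induction_linear with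
  | zero => simp only [map_zero]
  | add y z hy hz => rw [map_add, map_add, hy, hz, add_zero]
  | single s c =>
    have hcomp : evalTree op a k ∘ₗ (treeComp K i h).flip (Finsupp.single s c) =
        c • evalTree op (PTree.contractInputs a i s.1.leaves
          (s.1.eval (fun e x y => op e x y) fun l => a (i + l))) m := by
      refine Finsupp.lhom_ext fun t b => ?_
      simp only [LinearMap.comp_apply, LinearMap.flip_apply, treeComp_single, evalTree_single,
        LinearMap.smul_apply, graftArity, smul_smul, mul_comm b c,
        PTree.eval_graft _ t.1 s.1 (i.2.trans_eq t.2.symm)]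
    exact (LinearMap.congr_fun hcomp x).trans (by rw [LinearMap.smul_apply, hx, smul_zero])

theorem evalTree_treeComp_eq_zero_of_right {m n k : ℕ} (i : Fin m) (h : m + n = k + 1)
    (x : TreeModule K E m) {y : TreeModule K E n} (hy : ∀ a : ℕ → A, evalTree op a n y = 0)
    (a : ℕ → A) : evalTree op a k (treeComp K i h x y) = 0 := by
  induction x using Finsupp.induction_linear with
  | zero => simp only [map_zero, LinearMap.zero_apply]
  | add x z hx hz => rw [map_add, LinearMap.add_apply, map_add, hx, hz, add_zero]
  | single t c =>
    obtain ⟨φ, hφ⟩ := t.1.exists_linearMap_eval_update op (i.2.trans_eq t.2.symm)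
      fun j => if j < i then a j else a (j + n - 1)
    have hcomp : evalTree op a k ∘ₗ treeComp K i h (Finsupp.single t c) =
        c • φ ∘ₗ evalTree op (fun l => a (i + l)) n := by
      refine Finsupp.lhom_ext fun s b => ?_
      simp only [LinearMap.comp_apply, treeComp_single, evalTree_single, LinearMap.smul_apply,
        graftArity, PTree.eval_graft _ t.1 s.1 (i.2.trans_eq t.2.symm), PTree.contractInputs, s.2,
        hφ, map_smul, smul_smul]
    exact (LinearMap.congr_fun hcomp y).trans
      (by rw [LinearMap.smul_apply, LinearMap.comp_apply, hy, map_zero, smul_zero])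

theorem evalTree_eq_zero_of_idealMem {R : Submodule K (TreeModule K E 3)}
    (hA : IsAlgebraOfType R op) {n : ℕ} {x : (freeOperad K E).Op n}
    (hx : IdealMem (freeOperad K E) (relators R) n x) (a : ℕ → A) : evalTree op a n x = 0 := by
  induction hx generalizing a with
  | @of n x hx =>
    match n, x, hx with
    | 3, x, hx => exact hA x hx a
  | zero n => exact map_zero _
  | add x y _ _ hx hy => exact (map_add _ _ _).trans (by rw [hx, hy, add_zero])
  | smul c x _ hx => exact (map_smul _ _ _).trans (by rw [hx, smul_zero])
  | comp_left i h x y _ hx => exact evalTree_treeComp_eq_zero_of_left i h hx y a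
  | comp_right i h x y _ hy => exact evalTree_treeComp_eq_zero_of_right i h x hy a

/-- The value at the inputs `a 0, a 1, ...` of an operation of a quadratic operad, in an algebra
of the type defined by its relators. -/
def evalOp {R : Submodule K (TreeModule K E 3)} (hA : IsAlgebraOfType R op) (a : ℕ → A) (n : ℕ) :
    (quadraticOperad R).Op n →ₗ[K] A :=
  (ideal (freeOperad K E) (relators R) n).liftQ (evalTree op a n)
    fun _ hx => evalTree_eq_zero_of_idealMem hA hx a

theorem evalOp_treeClass {R : Submodule K (TreeModule K E 3)} (hA : IsAlgebraOfType R op)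
    (a : ℕ → A) {n : ℕ} (t : PTree E) (h : t.leaves = n) :
    evalOp hA a n (treeClass R t h) = t.eval (fun e x y => op e x y) a :=
  (Submodule.liftQ_apply _ _ _).trans ((evalTree_single op a n _ 1).trans (one_smul K _))

end Evaluation

/-! ### Trees with three leaves -/

section ThreeLeaves

variable {E : Type}

theorem PTree.eq_of_leaves_eq_one {t : PTree E} (h : t.leaves = 1) : t = leaf := by
  cases t with
  | leaf => rfl
  | node e l r =>
    have hl := l.leaves_pos
    have hr := r.leaves_pos
    simp only [leaves] at h
    omega

theorem PTree.exists_eq_of_leaves_eq_two {t : PTree E} (h : t.leaves = 2) :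
    ∃ e, t = node e leaf leaf := by
  cases t with
  | leaf => simp [leaves] at h
  | node e l r =>
    have hl := l.leaves_pos
    have hr := r.leaves_pos
    simp only [leaves] at h
    rw [eq_of_leaves_eq_one (show l.leaves = 1 by omega),
      eq_of_leaves_eq_one (show r.leaves = 1 by omega)]
    exact ⟨e, rfl⟩

/-- The tree of the operation `(x, y, z) ↦ (x f y) e z`. -/
def leftTree (e f : E) : {t : PTree E // t.leaves = 3} :=
  ⟨PTree.node e (PTree.node f PTree.leaf PTree.leaf) PTree.leaf, rfl⟩

/-- The tree of the operation `(x, y, z) ↦ x e (y f z)`. -/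
def rightTree (e f : E) : {t : PTree E // t.leaves = 3} :=
  ⟨PTree.node e PTree.leaf (PTree.node f PTree.leaf PTree.leaf), rfl⟩

theorem eq_leftTree_or_rightTree (t : {t : PTree E // t.leaves = 3}) :
    (∃ e f, t = leftTree e f) ∨ ∃ e f, t = rightTree e f := by
  obtain ⟨_ | ⟨e, l, r⟩, ht⟩ := t
  · simp [PTree.leaves] at ht
  have hl := l.leaves_pos
  have hr := r.leaves_pos
  have hlr : l.leaves + r.leaves = 3 := ht
  by_cases h : l.leaves = 1
  · obtain ⟨f, rfl⟩ := PTree.exists_eq_of_leaves_eq_two (show r.leaves = 2 by omega)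
    obtain rfl := PTree.eq_of_leaves_eq_one h
    exact Or.inr ⟨e, f, rfl⟩
  · obtain ⟨f, rfl⟩ := PTree.exists_eq_of_leaves_eq_two (show l.leaves = 2 by omega)
    obtain rfl := PTree.eq_of_leaves_eq_one (show r.leaves = 1 by omega)
    exact Or.inl ⟨e, f, rfl⟩

theorem leftTree_inj {e f e' f' : E} : leftTree e f = leftTree e' f' ↔ e = e' ∧ f = f' :=
  Subtype.ext_iff.trans (by simp [leftTree])

theorem rightTree_inj {e f e' f' : E} : rightTree e f = rightTree e' f' ↔ e = e' ∧ f = f' :=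
  Subtype.ext_iff.trans (by simp [rightTree])

theorem leftTree_ne_rightTree {e f e' f' : E} : leftTree e f ≠ rightTree e' f' :=
  fun h => by simpa [leftTree, rightTree] using Subtype.ext_iff.1 h

end ThreeLeaves

/-! ### The free algebra on one generator over a quadratic operad -/

section TotalSpace

variable {K : Type u} [Field K] {E : Type} (R : Submodule K (TreeModule K E 3))

/-- The projection of the free operad onto a quadratic operad. -/
def opClass (n : ℕ) : TreeModule K E n →ₗ[K] (quadraticOperad R).Op n :=
  (ideal (freeOperad K E) (relators R) n).mkQ

theorem opClass_single {n : ℕ} (t : {t : PTree E // t.leaves = n}) :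
    opClass R n (Finsupp.single t 1) = treeClass R t.1 t.2 := rfl

theorem treeClass_eq_one (t : PTree E) (h : t.leaves = 1) :
    treeClass R t h = (quadraticOperad R).one := by
  obtain rfl := PTree.eq_of_leaves_eq_one h
  rfl

theorem opClass_eq_zero {r : TreeModule K E 3} (hr : r ∈ R) : opClass R 3 r = 0 :=
  (Submodule.Quotient.mk_eq_zero _).2 (IdealMem.of (S := relators R) (n := 3) r hr)

theorem PTree.leaves_graft_of_eq {m n k : ℕ} (i : Fin m) (h : m + n = k + 1) {t s : PTree E}
    (ht : t.leaves = m) (hs : s.leaves = n) : (t.graft i s).leaves = k :=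
  (graftArity i h ⟨t, ht⟩ ⟨s, hs⟩).2

theorem comp_treeClass {m n k : ℕ} (i : Fin m) (h : m + n = k + 1) {t s : PTree E}
    (ht : t.leaves = m) (hs : s.leaves = n) :
    (quadraticOperad R).comp i h (treeClass R t ht) (treeClass R s hs) =
      treeClass R (t.graft i s) (PTree.leaves_graft_of_eq i h ht hs) := by
  have hts := treeComp_single K i h ⟨t, ht⟩ ⟨s, hs⟩ 1 1
  rw [mul_one] at hts
  exact (quotientComp_mk _ _ _ _ _ _).trans (congrArg _ hts)

variable {R} in
theorem op_hom_ext {n : ℕ} {N : Type w} [AddCommGroup N] [Module K N]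
    {f g : (quadraticOperad R).Op n →ₗ[K] N}
    (h : ∀ (t : PTree E) (ht : t.leaves = n), f (treeClass R t ht) = g (treeClass R t ht)) :
    f = g :=
  Submodule.linearMap_qext (ideal (freeOperad K E) (relators R) n) <|
    Finsupp.lhom_ext' fun t => LinearMap.ext_ring (h t.1 t.2)

theorem span_range_treeClass (n : ℕ) :
    Submodule.span K (Set.range fun t : {t : PTree E // t.leaves = n} => treeClass R t.1 t.2) =
      ⊤ := by
  refine (Submodule.ker_mkQ _).symm.trans (LinearMap.ker_eq_top.2 (op_hom_ext fun t ht => ?_))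
  exact (Submodule.Quotient.mk_eq_zero _).2 (Submodule.subset_span ⟨⟨t, ht⟩, rfl⟩)

/-- The class of a tree in the sum of all the spaces of operations. -/
def totalClass (t : PTree E) : TotalSpace R :=
  DirectSum.lof K ℕ (fun n => (quadraticOperad R).Op n) t.leaves (treeClass R t rfl)

theorem lof_treeClass {n : ℕ} (t : PTree E) (h : t.leaves = n) :
    DirectSum.lof K ℕ (fun n => (quadraticOperad R).Op n) n (treeClass R t h) =
      totalClass R t := by
  subst h
  rfl

variable {R} in
theorem totalSpace_hom_ext {N : Type w} [AddCommGroup N] [Module K N]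
    {f g : TotalSpace R →ₗ[K] N} (h : ∀ t, f (totalClass R t) = g (totalClass R t)) : f = g :=
  DirectSum.linearMap_ext K fun n => op_hom_ext fun t ht => by
    simp only [LinearMap.comp_apply, lof_treeClass, h]

theorem span_range_totalClass : Submodule.span K (Set.range (totalClass R)) = ⊤ := by
  refine (Submodule.ker_mkQ _).symm.trans (LinearMap.ker_eq_top.2 (totalSpace_hom_ext fun t => ?_))
  exact (Submodule.Quotient.mk_eq_zero _).2 (Submodule.subset_span ⟨t, rfl⟩)

theorem gradedProduct_apply (e : E) {m n : ℕ} (x : (quadraticOperad R).Op m)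
    (y : (quadraticOperad R).Op n) :
    gradedProduct R e m n x y =
      (quadraticOperad R).comp (0 : Fin (n + 1)) (by omega : n + 1 + m = m + n + 1)
        ((quadraticOperad R).comp (1 : Fin 2) (by omega : 2 + n = n + 1 + 1)
          (generator R e) y) x := rfl

theorem gradedProduct_treeClass (e : E) (t s : PTree E) :
    gradedProduct R e t.leaves s.leaves (treeClass R t rfl) (treeClass R s rfl) =
      treeClass R (.node e t s) rfl := by
  have he : (PTree.node e .leaf .leaf).leaves = 2 := rfl
  have hs := comp_treeClass R (1 : Fin 2) (by omega : 2 + s.leaves = s.leaves + 1 + 1) he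
    (s := s) rfl
  rw [gradedProduct_apply]
  refine (congrArg (fun x => (quadraticOperad R).comp _ _ x _) hs).trans ?_
  rw [comp_treeClass]
  simp [PTree.graft, PTree.leaves]

theorem totalProduct_totalClass (e : E) (t s : PTree E) :
    totalProduct R e (totalClass R t) (totalClass R s) = totalClass R (.node e t s) := by
  rw [totalClass, totalClass, totalProduct, DirectSum.toModule_lof, LinearMap.flip_apply,
    DirectSum.toModule_lof, LinearMap.flip_apply, LinearMap.compr₂_apply, gradedProduct_treeClass]
  rfl

theorem evalTree_totalProduct_totalClass (s : ℕ → PTree E) :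
    evalTree (totalProduct R) (fun j => totalClass R (s j)) 3 =
      DirectSum.lof K ℕ (fun n => (quadraticOperad R).Op n)
          ((s 0).leaves + (s 1).leaves + (s 2).leaves) ∘ₗ
        ((quadraticOperad R).comp (0 : Fin ((s 1).leaves + (s 2).leaves + 1)) (by omega)).flip
          (treeClass R (s 0) rfl) ∘ₗ
        ((quadraticOperad R).comp (1 : Fin ((s 2).leaves + 2)) (by omega)).flip
          (treeClass R (s 1) rfl) ∘ₗ
        ((quadraticOperad R).comp (2 : Fin 3) (by omega)).flip (treeClass R (s 2) rfl) ∘ₗ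
        opClass R 3 := by
  refine Finsupp.lhom_ext' fun t => LinearMap.ext_ring ?_
  simp only [LinearMap.comp_apply, LinearMap.flip_apply, Finsupp.lsingle_apply, evalTree_single,
    one_smul, opClass_single, comp_treeClass, lof_treeClass]
  rcases eq_leftTree_or_rightTree t with ⟨e, f, rfl⟩ | ⟨e, f, rfl⟩ <;>
    simp [leftTree, rightTree, PTree.eval, PTree.graft, PTree.leaves, totalProduct_totalClass]

theorem isAlgebraOfType_totalProduct : IsAlgebraOfType R (totalProduct R) := by
  intro r hr a
  refine evalTree_eq_zero_of_span_eq_top (span_range_totalClass R) (fun a ha => ?_) a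
  have : Nonempty (PTree E) := ⟨.leaf⟩
  choose! s hs using ha
  have hsa : evalTree (totalProduct R) a 3 = evalTree (totalProduct R) (totalClass R ∘ s) 3 :=
    Finsupp.lhom_ext fun t c => by
      simp only [evalTree_single]
      rw [PTree.eval_congr _ t.1 fun j hj => (hs j (hj.trans_eq t.2)).symm]
      rfl
  rw [hsa]
  refine (LinearMap.congr_fun (evalTree_totalProduct_totalClass R s) r).trans ?_
  simp only [LinearMap.comp_apply, opClass_eq_zero R hr, map_zero]

section Lift

variable {A : Type w} [AddCommGroup A] [Module K A] {op : E → A →ₗ[K] A →ₗ[K] A}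

variable {R}

/-- The morphism of algebras from the sum of all the spaces of operations, which maps the identity
operation to `b`. -/
def totalLift (hA : IsAlgebraOfType R op) (b : A) : TotalSpace R →ₗ[K] A :=
  DirectSum.toModule K ℕ A (evalOp hA fun _ => b)

theorem totalLift_totalClass (hA : IsAlgebraOfType R op) (b : A) (t : PTree E) :
    totalLift hA b (totalClass R t) = t.eval (fun e x y => op e x y) fun _ => b :=
  (DirectSum.toModule_lof K _ _).trans (evalOp_treeClass hA _ t rfl)

theorem totalLift_totalProduct (hA : IsAlgebraOfType R op) (b : A) (e : E) (x y : TotalSpace R) :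
    totalLift hA b (totalProduct R e x y) = op e (totalLift hA b x) (totalLift hA b y) := by
  suffices h : (totalProduct R e).compr₂ (totalLift hA b) =
      (op e).compl₁₂ (totalLift hA b) (totalLift hA b) from LinearMap.congr_fun₂ h x y
  refine totalSpace_hom_ext fun t => totalSpace_hom_ext fun s => ?_
  simp only [LinearMap.compr₂_apply, LinearMap.compl₁₂_apply, totalProduct_totalClass,
    totalLift_totalClass, PTree.eval]

theorem eq_totalLift (hA : IsAlgebraOfType R op) {b : A} {g : TotalSpace R →ₗ[K] A}
    (hg : ∀ e x y, g (totalProduct R e x y) = op e (g x) (g y))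
    (hb : g (totalClass R .leaf) = b) : g = totalLift hA b := by
  refine totalSpace_hom_ext fun t => ?_
  rw [totalLift_totalClass]
  induction t with
  | leaf => exact hb
  | node e t s ht hs => rw [← totalProduct_totalClass, hg, ht, hs, PTree.eval]

end Lift

theorem totalClass_eq_eval (t : PTree E) :
    totalClass R t =
      t.eval (fun e x y => totalProduct R e x y) fun _ => totalClass R .leaf := by
  induction t with
  | leaf => rfl
  | node e t s ht hs => rw [← totalProduct_totalClass, ht, hs, PTree.eval]

theorem component_one_totalProduct (e : E) (x y : TotalSpace R) :
    DirectSum.component K ℕ (fun n => (quadraticOperad R).Op n) 1 (totalProduct R e x y) = 0 := by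
  suffices h : (totalProduct R e).compr₂
      (DirectSum.component K ℕ (fun n => (quadraticOperad R).Op n) 1) = 0 from
    LinearMap.congr_fun₂ h x y
  refine totalSpace_hom_ext fun t => totalSpace_hom_ext fun s => ?_
  have ht := t.leaves_pos
  have hs := s.leaves_pos
  rw [LinearMap.compr₂_apply, totalProduct_totalClass, totalClass, DirectSum.component.of, dif_neg]
  · rfl
  · simp only [PTree.leaves]
    omega

end TotalSpace

/-! ### The relators of the Koszul dual -/

section Relators

variable {K : Type u} [Field K]

theorem leftComb_eq_single {E : Type} (e f : E) :
    leftComb K e f = Finsupp.single (leftTree e f) 1 := rfl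

theorem rightComb_eq_single {E : Type} (e f : E) :
    rightComb K e f = Finsupp.single (rightTree e f) 1 := rfl

section Pairing

variable {E : Type}

variable (K E) in
/-- The pairing between the arity `3` parts of the free operads on the generators and on the dual
generators. -/
def relatorPairing : TreeModule K E 3 →ₗ[K] TreeModule K E 3 →ₗ[K] K :=
  Finsupp.linearCombination K fun t => (t.1.sign : K) • Finsupp.lapply t

theorem mem_orthogonal_iff {R : Submodule K (TreeModule K E 3)} {x : TreeModule K E 3} :
    x ∈ orthogonal R ↔ R ≤ LinearMap.ker (relatorPairing K E x) := by
  simp only [orthogonal, Submodule.mem_iInf, LinearMap.mem_ker, SetLike.le_def]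
  refine forall₂_congr fun r _ => ?_
  simp [relatorPairing, Finsupp.linearCombination_apply, Finsupp.sum, LinearMap.sum_apply]

theorem relatorPairing_single_right (x : TreeModule K E 3) (t : {t : PTree E // t.leaves = 3}) :
    relatorPairing K E x (Finsupp.single t 1) = t.1.sign * x t := by
  classical
  induction x using Finsupp.induction_linear with
  | zero => simp
  | add x y hx hy => rw [map_add, LinearMap.add_apply, hx, hy, Finsupp.add_apply, mul_add]
  | single s c =>
    rcases eq_or_ne s t with rfl | h
    · simp [relatorPairing, mul_comm]
    · simp [relatorPairing, h, h.symm]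

theorem relatorPairing_leftComb (x : TreeModule K E 3) (e f : E) :
    relatorPairing K E x (leftComb K e f) = x (leftTree e f) := by
  rw [leftComb_eq_single, relatorPairing_single_right]
  simp [leftTree, PTree.sign]

theorem relatorPairing_rightComb (x : TreeModule K E 3) (e f : E) :
    relatorPairing K E x (rightComb K e f) = -x (rightTree e f) := by
  rw [rightComb_eq_single, relatorPairing_single_right]
  simp [rightTree, PTree.sign]

theorem mem_orthogonal_span {S : Set (TreeModule K E 3)} {x : TreeModule K E 3} :
    x ∈ orthogonal (Submodule.span K S) ↔ ∀ r ∈ S, relatorPairing K E x r = 0 :=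
  mem_orthogonal_iff.trans Submodule.span_le

end Pairing

theorem mem_orthogonal_dupRelators {x : TreeModule K DupGen 3} :
    x ∈ orthogonal (dupRelators K) ↔
      x (leftTree .left .left) + x (rightTree .left .left) = 0 ∧
      x (leftTree .left .right) + x (rightTree .right .left) = 0 ∧
      x (leftTree .right .right) + x (rightTree .right .right) = 0 := by
  simp only [dupRelators, mem_orthogonal_span, Set.mem_insert_iff, Set.mem_singleton_iff,
    forall_eq_or_imp, forall_eq, map_sub, relatorPairing_leftComb, relatorPairing_rightComb,
    sub_neg_eq_add]

theorem eq_of_mem_orthogonal_dupRelators {x : TreeModule K DupGen 3}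
    (hx : x ∈ orthogonal (dupRelators K)) :
    x = (x (leftTree .left .left) • (leftComb K .left .left - rightComb K .left .left) +
        x (leftTree .left .right) • (leftComb K .left .right - rightComb K .right .left) +
        x (leftTree .right .right) • (leftComb K .right .right - rightComb K .right .right)) +
      (x (leftTree .right .left) • leftComb K .right .left +
        x (rightTree .left .right) • rightComb K .left .right) := by
  classical
  obtain ⟨hll, hlr, hrr⟩ := mem_orthogonal_dupRelators.1 hx
  ext t
  simp only [leftComb_eq_single, rightComb_eq_single, Finsupp.add_apply, Finsupp.smul_apply,
    Finsupp.sub_apply, Finsupp.single_apply]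
  rcases eq_leftTree_or_rightTree t with ⟨e, f, rfl⟩ | ⟨e, f, rfl⟩ <;> cases e <;> cases f <;>
    simp [leftTree_inj, rightTree_inj, leftTree_ne_rightTree, leftTree_ne_rightTree.symm,
      eq_neg_of_add_eq_zero_left hll, eq_neg_of_add_eq_zero_left hlr,
      eq_neg_of_add_eq_zero_left hrr]

theorem dupRelators_le_orthogonal : dupRelators K ≤ orthogonal (dupRelators K) := by
  classical
  refine Submodule.span_le.2 ?_
  rintro _ (rfl | rfl | rfl) <;> refine mem_orthogonal_dupRelators.2 ?_ <;>
    simp [leftComb_eq_single, rightComb_eq_single, leftTree_inj, rightTree_inj,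
      leftTree_ne_rightTree, leftTree_ne_rightTree.symm]

theorem dupExtraRelators_le_orthogonal : dupExtraRelators K ≤ orthogonal (dupRelators K) := by
  classical
  refine Submodule.span_le.2 ?_
  rintro _ (rfl | rfl) <;> refine mem_orthogonal_dupRelators.2 ?_ <;>
    simp [leftComb_eq_single, rightComb_eq_single, leftTree_inj, rightTree_inj,
      leftTree_ne_rightTree, leftTree_ne_rightTree.symm]

theorem orthogonal_dupRelators :
    orthogonal (dupRelators K) = dupRelators K ⊔ dupExtraRelators K := by
  refine le_antisymm (fun x hx => ?_)
    (sup_le dupRelators_le_orthogonal dupExtraRelators_le_orthogonal)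
  rw [eq_of_mem_orthogonal_dupRelators hx]
  refine Submodule.add_mem_sup (add_mem (add_mem ?_ ?_) ?_) (add_mem ?_ ?_) <;>
    exact Submodule.smul_mem _ _ (Submodule.subset_span (by simp))

end Relators

/-! ### Algebras over the duplicial operad and over its Koszul dual -/

section Algebras

variable {K : Type u} [Field K] {A : Type w} [AddCommGroup A] [Module K A]

theorem isAlgebraOfType_iff {E : Type} {R : Submodule K (TreeModule K E 3)}
    {op : E → A →ₗ[K] A →ₗ[K] A} :
    IsAlgebraOfType R op ↔ ∀ a, R ≤ LinearMap.ker (evalTree op a 3) :=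
  ⟨fun h a r hr => h r hr a, fun h _ hr a => h a hr⟩

theorem evalTree_leftComb {E : Type} (op : E → A →ₗ[K] A →ₗ[K] A) (a : ℕ → A) (e f : E) :
    evalTree op a 3 (leftComb K e f) = op e (op f (a 0) (a 1)) (a 2) :=
  (evalTree_single op a 3 _ 1).trans (one_smul K _)

theorem evalTree_rightComb {E : Type} (op : E → A →ₗ[K] A →ₗ[K] A) (a : ℕ → A) (e f : E) :
    evalTree op a 3 (rightComb K e f) = op e (a 0) (op f (a 1) (a 2)) :=
  (evalTree_single op a 3 _ 1).trans (one_smul K _)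

theorem forall_nat_fun_three {X : Type w} {p : X → X → X → Prop} :
    (∀ a : ℕ → X, p (a 0) (a 1) (a 2)) ↔ ∀ x y z, p x y z :=
  ⟨fun h x y z => h fun n => match n with
    | 0 => x
    | 1 => y
    | _ => z, fun h _ => h _ _ _⟩

variable {op : DupGen → A →ₗ[K] A →ₗ[K] A}

theorem isAlgebraOfType_dupRelators_iff_relations :
    IsAlgebraOfType (dupRelators K) op ↔ ∀ x y z : A,
      (op .left (op .left x y) z = op .left x (op .left y z)) ∧
      (op .left (op .right x y) z = op .right x (op .left y z)) ∧
      (op .right (op .right x y) z = op .right x (op .right y z)) := by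
  rw [isAlgebraOfType_iff, ← forall_nat_fun_three]
  refine forall_congr' fun a => ?_
  rw [dupRelators, Submodule.span_le]
  simp [Set.insert_subset_iff, evalTree_leftComb, evalTree_rightComb, sub_eq_zero]

theorem isAlgebraOfType_dupRelators_iff :
    IsAlgebraOfType (dupRelators K) op ↔ ∃ D : DuplicialAlgebra K A, D.op = op := by
  rw [isAlgebraOfType_dupRelators_iff_relations]
  constructor
  · intro h
    refine ⟨⟨op .left, op .right, fun x y z => (h x y z).1, fun x y z => (h x y z).2.1,
      fun x y z => (h x y z).2.2⟩, ?_⟩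
    funext e
    cases e <;> rfl
  · rintro ⟨D, rfl⟩ x y z
    exact ⟨D.left_left x y z, D.right_left x y z, D.right_right x y z⟩

theorem isAlgebraOfType_sup_iff {E : Type} {R S : Submodule K (TreeModule K E 3)}
    {op : E → A →ₗ[K] A →ₗ[K] A} :
    IsAlgebraOfType (R ⊔ S) op ↔ IsAlgebraOfType R op ∧ IsAlgebraOfType S op := by
  simp only [isAlgebraOfType_iff, sup_le_iff, forall_and]

theorem isAlgebraOfType_dupExtraRelators_iff :
    IsAlgebraOfType (dupExtraRelators K) op ↔ ∀ x y z : A,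
      (op .right (op .left x y) z = 0) ∧ op .left x (op .right y z) = 0 := by
  rw [isAlgebraOfType_iff, ← forall_nat_fun_three]
  refine forall_congr' fun a => ?_
  rw [dupExtraRelators, Submodule.span_le]
  simp [Set.insert_subset_iff, evalTree_leftComb, evalTree_rightComb]

theorem isAlgebraOfType_orthogonal_dupRelators_iff :
    IsAlgebraOfType (orthogonal (dupRelators K)) op ↔ ∃ D : DuplicialAlgebra K A, D.op = op ∧
      (∀ x y z : A, D.right (D.left x y) z = 0) ∧ ∀ x y z : A, D.left x (D.right y z) = 0 := by
  rw [orthogonal_dupRelators, isAlgebraOfType_sup_iff, isAlgebraOfType_dupRelators_iff,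
    isAlgebraOfType_dupExtraRelators_iff]
  constructor
  · rintro ⟨⟨D, rfl⟩, h⟩
    exact ⟨D, rfl, fun x y z => (h x y z).1, fun x y z => (h x y z).2⟩
  · rintro ⟨D, rfl, hrl, hlr⟩
    exact ⟨⟨D, rfl⟩, fun x y z => ⟨hrl x y z, hlr x y z⟩⟩

end Algebras

/-! ### Monomials of the Koszul dual -/

section Monomials

variable {K : Type u} [Field K] {A : Type w} [AddCommGroup A] [Module K A]

namespace DuplicialAlgebra

/-- The value of a tree of operations of a duplicial algebra when all its inputs are `x`. -/
def evalAt (D : DuplicialAlgebra K A) (x : A) (t : PTree DupGen) : A :=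
  t.eval (fun e y z => D.op e y z) fun _ => x

/-- The value of the monomial `x ≻ ⋯ ≻ x ≺ ⋯ ≺ x`, with `p` operations `≻` and `q` operations
`≺`. -/
def monomial (D : DuplicialAlgebra K A) (x : A) (p q : ℕ) : A := D.evalAt x (dupMonomial p q)

/-- A duplicial algebra in which `(x ≺ y) ≻ z = 0 = x ≺ (y ≻ z)`, that is, an algebra over the
Koszul dual operad (see `isAlgebraOfType_orthogonal_dupRelators_iff`). -/
structure IsKoszulDual (D : DuplicialAlgebra K A) : Prop where
  right_left_eq_zero : ∀ x y z, D.right (D.left x y) z = 0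
  left_right_eq_zero : ∀ x y z, D.left x (D.right y z) = 0

variable (D : DuplicialAlgebra K A) (x : A)

theorem evalAt_leaf : D.evalAt x .leaf = x := rfl

theorem evalAt_node_left (t s : PTree DupGen) :
    D.evalAt x (.node .left t s) = D.left (D.evalAt x t) (D.evalAt x s) := rfl

theorem evalAt_node_right (t s : PTree DupGen) :
    D.evalAt x (.node .right t s) = D.right (D.evalAt x t) (D.evalAt x s) := rfl

theorem monomial_zero_zero : D.monomial x 0 0 = x := by
  rw [monomial, dupMonomial, evalAt_leaf]

theorem monomial_succ_left (p q : ℕ) :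
    D.monomial x (p + 1) q = D.right x (D.monomial x p q) := by
  rw [monomial, dupMonomial, evalAt_node_right, evalAt_leaf, monomial]

theorem monomial_succ_right (p q : ℕ) :
    D.monomial x p (q + 1) = D.left (D.monomial x p q) x := by
  induction p with
  | zero => rw [monomial, dupMonomial, evalAt_node_left, evalAt_leaf, monomial]
  | succ p ih => rw [monomial_succ_left, ih, ← right_left, ← monomial_succ_left]

theorem right_monomial_zero (p p' q : ℕ) :
    D.right (D.monomial x p 0) (D.monomial x p' q) = D.monomial x (p + p' + 1) q := by
  induction p with
  | zero => rw [monomial_zero_zero, ← monomial_succ_left, zero_add]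
  | succ p ih =>
    rw [monomial_succ_left, right_right, ih, ← monomial_succ_left, add_right_comm p p' 1]

theorem left_monomial_zero (p q q' : ℕ) :
    D.left (D.monomial x p q) (D.monomial x 0 q') = D.monomial x p (q + q' + 1) := by
  induction q' with
  | zero => rw [monomial_zero_zero, ← monomial_succ_right, add_zero]
  | succ q' ih => rw [monomial_succ_right, ← left_left, ih, ← monomial_succ_right, add_assoc q q']

namespace IsKoszulDual

variable {D}

theorem right_monomial_succ (hD : D.IsKoszulDual) (p q : ℕ) (z : A) :
    D.right (D.monomial x p (q + 1)) z = 0 := by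
  rw [monomial_succ_right, hD.right_left_eq_zero]

theorem left_monomial_succ (hD : D.IsKoszulDual) (p q : ℕ) (z : A) :
    D.left z (D.monomial x (p + 1) q) = 0 := by
  rw [monomial_succ_left, hD.left_right_eq_zero]

theorem evalAt_eq_zero_or_eq_monomial (hD : D.IsKoszulDual) (t : PTree DupGen) :
    D.evalAt x t = 0 ∨ ∃ p q, p + q + 1 = t.leaves ∧ D.evalAt x t = D.monomial x p q := by
  induction t with
  | leaf => exact Or.inr ⟨0, 0, rfl, (D.monomial_zero_zero x).symm⟩
  | node e l r hl hr =>
    rcases hl with hl | ⟨p, q, h, hl⟩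
    · exact Or.inl (by cases e <;> simp only [evalAt_node_left, evalAt_node_right, hl, map_zero,
        LinearMap.zero_apply])
    rcases hr with hr | ⟨p', q', h', hr⟩
    · exact Or.inl (by cases e <;> simp only [evalAt_node_left, evalAt_node_right, hr, map_zero])
    cases e with
    | left =>
      rw [evalAt_node_left, hl, hr]
      rcases p' with _ | p'
      · refine Or.inr ⟨p, q + q' + 1, ?_, D.left_monomial_zero x p q q'⟩
        simp only [PTree.leaves]
        omega
      · exact Or.inl (hD.left_monomial_succ x p' q' _)
    | right =>
      rw [evalAt_node_right, hl, hr]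
      rcases q with _ | q
      · refine Or.inr ⟨p + p' + 1, q', ?_, D.right_monomial_zero x p p' q'⟩
        simp only [PTree.leaves]
        omega
      · exact Or.inl (hD.right_monomial_succ x p q _)

theorem evalAt_graft_right (hD : D.IsKoszulDual) {p q i : ℕ} (hi : i < p + q + 1) :
    D.evalAt x ((dupMonomial p q).graft i (.node .right .leaf .leaf)) =
      if i ≤ p then D.monomial x (p + 1) q else 0 := by
  induction p generalizing i with
  | zero =>
    induction q generalizing i with
    | zero =>
      obtain rfl : i = 0 := by omega
      rw [dupMonomial, PTree.graft, if_pos le_rfl, monomial, dupMonomial, dupMonomial]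
    | succ q ih =>
      rw [dupMonomial, PTree.graft, leaves_dupMonomial]
      by_cases h : i < 0 + q + 1
      · rw [if_pos h, evalAt_node_left, ih h, evalAt_leaf, monomial_succ_right]
        split_ifs
        · rfl
        · rw [map_zero, LinearMap.zero_apply]
      · rw [if_neg h, PTree.graft, evalAt_node_left, evalAt_node_right, hD.left_right_eq_zero,
          if_neg (by omega)]
  | succ p ih =>
    rw [dupMonomial, PTree.graft, PTree.leaves]
    rcases i with _ | i
    · rw [if_pos one_pos, if_pos (Nat.zero_le _), PTree.graft, evalAt_node_right,
        evalAt_node_right, evalAt_leaf, right_right, monomial_succ_left, monomial_succ_left,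
        monomial]
    · rw [if_neg (by omega), Nat.add_sub_cancel, evalAt_node_right, ih (by omega), evalAt_leaf,
        monomial_succ_left D x (p + 1)]
      simp only [add_le_add_iff_right]
      split_ifs
      · rfl
      · rw [map_zero]

theorem evalAt_graft_left (hD : D.IsKoszulDual) {p q i : ℕ} (hi : i < p + q + 1) :
    D.evalAt x ((dupMonomial p q).graft i (.node .left .leaf .leaf)) =
      if p ≤ i then D.monomial x p (q + 1) else 0 := by
  induction p generalizing i with
  | zero =>
    rw [if_pos (Nat.zero_le _)]
    induction q generalizing i with
    | zero =>
      obtain rfl : i = 0 := by omega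
      rw [dupMonomial, PTree.graft, monomial, dupMonomial, dupMonomial]
    | succ q ih =>
      rw [dupMonomial, PTree.graft, leaves_dupMonomial]
      by_cases h : i < 0 + q + 1
      · rw [if_pos h, evalAt_node_left, ih h, evalAt_leaf, ← monomial_succ_right]
      · rw [if_neg h, PTree.graft, evalAt_node_left, evalAt_node_left, evalAt_leaf, ← left_left,
          ← monomial, ← monomial_succ_right, ← monomial_succ_right]
  | succ p ih =>
    rw [dupMonomial, PTree.graft, PTree.leaves]
    rcases i with _ | i
    · rw [if_pos one_pos, if_neg (by omega), PTree.graft, evalAt_node_right, evalAt_node_left,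
        hD.right_left_eq_zero]
    · rw [if_neg (by omega), Nat.add_sub_cancel, evalAt_node_right, ih (by omega), evalAt_leaf,
        monomial_succ_left D x p]
      simp only [add_le_add_iff_right]
      split_ifs
      · rfl
      · rw [map_zero]

end IsKoszulDual

end DuplicialAlgebra

end Monomials

section TwistedAlgebra

variable {K : Type u} [Field K] {B : Type w} [CommRing B] [Algebra K B] {s t : B}
  {φ ψ : B →ₐ[K] B}

/-- The duplicial algebra with `x ≻ y = s φ(x) y` and `x ≺ y = t x ψ(y)`, where `φ` and `ψ` are
idempotent endomorphisms which fix `s` and `t`, respectively. -/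
def twistedDuplicial (hφ : ∀ x, φ (φ x) = φ x) (hψ : ∀ x, ψ (ψ x) = ψ x) (hs : φ s = s)
    (ht : ψ t = t) : DuplicialAlgebra K B where
  left := (LinearMap.mul K B ∘ₗ LinearMap.mulLeft K t).compl₂ ψ.toLinearMap
  right := LinearMap.mul K B ∘ₗ LinearMap.mulLeft K s ∘ₗ φ.toLinearMap
  left_left x y z := by
    change t * (t * x * ψ y) * ψ z = t * x * ψ (t * y * ψ z)
    rw [map_mul, map_mul, hψ, ht]
    ring
  right_left x y z := by
    change t * (s * φ x * y) * ψ z = s * φ x * (t * y * ψ z)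
    ring
  right_right x y z := by
    change s * φ (s * φ x * y) * z = s * φ x * (s * φ y * z)
    rw [map_mul, map_mul, hφ, hs]
    ring

variable (hφ : ∀ x, φ (φ x) = φ x) (hψ : ∀ x, ψ (ψ x) = ψ x) (hs : φ s = s) (ht : ψ t = t)

theorem isKoszulDual_twistedDuplicial (hφt : φ t = 0) (hψs : ψ s = 0) :
    (twistedDuplicial hφ hψ hs ht).IsKoszulDual where
  right_left_eq_zero x y z := by
    change s * φ (t * x * ψ y) * z = 0
    rw [map_mul, map_mul, hφt, zero_mul, zero_mul, mul_zero, zero_mul]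
  left_right_eq_zero x y z := by
    change t * x * ψ (s * φ y * z) = 0
    rw [map_mul, map_mul, hψs, zero_mul, zero_mul, mul_zero]

theorem monomial_twistedDuplicial (p q : ℕ) :
    (twistedDuplicial hφ hψ hs ht).monomial 1 p q = s ^ p * t ^ q := by
  induction p with
  | zero =>
    induction q with
    | zero => rw [DuplicialAlgebra.monomial_zero_zero, pow_zero, pow_zero, one_mul]
    | succ q ih =>
      rw [DuplicialAlgebra.monomial_succ_right, ih]
      change t * (s ^ 0 * t ^ q) * ψ 1 = s ^ 0 * t ^ (q + 1)
      rw [map_one]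
      ring
  | succ p ih =>
    rw [DuplicialAlgebra.monomial_succ_left, ih]
    change s * φ 1 * (s ^ p * t ^ q) = s ^ (p + 1) * t ^ q
    rw [map_one]
    ring

end TwistedAlgebra

section PolynomialModel

open MvPolynomial

variable (K : Type u) [Field K]

/-- The endomorphism of a polynomial algebra which keeps the variable `b` and sends the other
variables to `0`. -/
def keepVar (b : Bool) : MvPolynomial Bool K →ₐ[K] MvPolynomial Bool K :=
  aeval (Pi.single b (X b))

theorem keepVar_X_self (b : Bool) : keepVar K b (X b) = X b := by
  rw [keepVar, aeval_X, Pi.single_eq_same]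

theorem keepVar_X_of_ne {b c : Bool} (h : c ≠ b) : keepVar K b (X c) = 0 := by
  rw [keepVar, aeval_X, Pi.single_eq_of_ne h]

theorem keepVar_keepVar (b : Bool) (x : MvPolynomial Bool K) :
    keepVar K b (keepVar K b x) = keepVar K b x := by
  suffices h : (keepVar K b).comp (keepVar K b) = keepVar K b from DFunLike.congr_fun h x
  refine MvPolynomial.algHom_ext fun c => ?_
  rw [AlgHom.comp_apply]
  rcases eq_or_ne c b with rfl | h
  · rw [keepVar_X_self, keepVar_X_self]
  · rw [keepVar_X_of_ne K h, map_zero]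

/-- The duplicial algebra `K[s, t]` with `x ≻ y = s x(s, 0) y` and `x ≺ y = t x y(0, t)`, where
`s = X true` and `t = X false`.  It separates the monomials of the Koszul dual. -/
def polynomialDuplicial : DuplicialAlgebra K (MvPolynomial Bool K) :=
  twistedDuplicial (keepVar_keepVar K true) (keepVar_keepVar K false) (keepVar_X_self K true)
    (keepVar_X_self K false)

theorem isAlgebraOfType_polynomialDuplicial :
    IsAlgebraOfType (orthogonal (dupRelators K)) (polynomialDuplicial K).op :=
  have h : (polynomialDuplicial K).IsKoszulDual := isKoszulDual_twistedDuplicial _ _ _ _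
    (keepVar_X_of_ne K Bool.false_ne_true) (keepVar_X_of_ne K Bool.false_ne_true.symm)
  isAlgebraOfType_orthogonal_dupRelators_iff.2
    ⟨_, rfl, h.right_left_eq_zero, h.left_right_eq_zero⟩

theorem linearIndependent_X_pow_mul_X_pow (n : ℕ) :
    LinearIndependent K
      fun p : Fin (n + 1) => (X true ^ (p : ℕ) * X false ^ (n - p) : MvPolynomial Bool K) := by
  have h : Function.Injective fun p : Fin (n + 1) =>
      Finsupp.single true (p : ℕ) + Finsupp.single false (n - (p : ℕ)) := fun p p' h =>
    Fin.ext (by simpa using DFunLike.congr_fun h true)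
  suffices hX : (fun p : Fin (n + 1) => (X true ^ (p : ℕ) * X false ^ (n - p) :
      MvPolynomial Bool K)) = basisMonomials Bool K ∘ fun p : Fin (n + 1) =>
        Finsupp.single true (p : ℕ) + Finsupp.single false (n - (p : ℕ)) from
    hX ▸ (basisMonomials Bool K).linearIndependent.comp _ h
  funext p
  rw [Function.comp_apply, coe_basisMonomials, X_pow_eq_monomial, X_pow_eq_monomial, monomial_mul,
    mul_one]

end PolynomialModel

/-! ### A basis of the Koszul dual -/

section DualBasis

variable (K : Type u) [Field K]

theorem treeClass_eq_of_totalClass_eq {E : Type} {R : Submodule K (TreeModule K E 3)} {n : ℕ}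
    {t s : PTree E} (ht : t.leaves = n) (hs : s.leaves = n)
    (h : totalClass R t = totalClass R s) : treeClass R t ht = treeClass R s hs := by
  rw [← lof_treeClass R t ht, ← lof_treeClass R s hs] at h
  exact DirectSum.of_injective (β := fun n => (quadraticOperad R).Op n) n h

theorem treeClass_eq_zero_of_totalClass_eq {E : Type} {R : Submodule K (TreeModule K E 3)} {n : ℕ}
    {t : PTree E} (ht : t.leaves = n) (h : totalClass R t = 0) : treeClass R t ht = 0 := by
  rw [← lof_treeClass R t ht] at h
  exact DirectSum.of_injective (β := fun n => (quadraticOperad R).Op n) n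
    (h.trans (map_zero _).symm)

theorem exists_isKoszulDual_totalClass_eq :
    ∃ D : DuplicialAlgebra K (TotalSpace (orthogonal (dupRelators K))), D.IsKoszulDual ∧
      ∀ t, totalClass _ t = D.evalAt (totalClass _ .leaf) t := by
  obtain ⟨D, hD, hrl, hlr⟩ :=
    isAlgebraOfType_orthogonal_dupRelators_iff.1
      (isAlgebraOfType_totalProduct (orthogonal (dupRelators K)))
  refine ⟨D, ⟨hrl, hlr⟩, fun t => ?_⟩
  rw [totalClass_eq_eval, DuplicialAlgebra.evalAt, hD]

/-- The monomial `x ≻ ⋯ ≻ x ≺ ⋯ ≺ x`, with `p` operations `≻` and `q` operations `≺`, as an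
operation of the Koszul dual. -/
def monOp (p q : ℕ) {n : ℕ} (h : p + q + 1 = n) : (koszulDual (dupRelators K)).Op n :=
  treeClass (orthogonal (dupRelators K)) (dupMonomial p q) ((leaves_dupMonomial p q).trans h)

theorem treeClass_eq_zero_or_eq_monOp {n : ℕ} (t : PTree DupGen) (ht : t.leaves = n) :
    treeClass (orthogonal (dupRelators K)) t ht = 0 ∨
      ∃ p q, ∃ h : p + q + 1 = n, treeClass (orthogonal (dupRelators K)) t ht = monOp K p q h := by
  obtain ⟨D, hD, hcl⟩ := exists_isKoszulDual_totalClass_eq K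
  refine (hD.evalAt_eq_zero_or_eq_monomial (totalClass _ .leaf) t).imp (fun h => ?_) ?_
  · exact treeClass_eq_zero_of_totalClass_eq K ht ((hcl t).trans h)
  · rintro ⟨p, q, h, heq⟩
    exact ⟨p, q, h.trans ht, treeClass_eq_of_totalClass_eq K _ _
      ((hcl t).trans (heq.trans (hcl _).symm))⟩

theorem insertGenerator_right_monOp (p q : ℕ) {n : ℕ} (h : p + q + 1 = n) (i : Fin n) :
    insertGenerator (dupRelators K) .right i (monOp K p q h) =
      if (i : ℕ) ≤ p then monOp K (p + 1) q (by omega) else 0 := by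
  obtain ⟨D, hD, hcl⟩ := exists_isKoszulDual_totalClass_eq K
  have hi : (i : ℕ) < p + q + 1 := h ▸ i.2
  have hgraft := (hcl _).trans (hD.evalAt_graft_right (totalClass _ .leaf) hi)
  rw [DuplicialAlgebra.monomial, ← hcl] at hgraft
  refine (comp_treeClass (orthogonal (dupRelators K)) i (rfl : n + 2 = n + 1 + 1)
    ((leaves_dupMonomial p q).trans h) (s := .node .right .leaf .leaf) rfl).trans ?_
  split_ifs at hgraft ⊢
  · exact treeClass_eq_of_totalClass_eq K _ _ hgraft
  · exact treeClass_eq_zero_of_totalClass_eq K _ hgraft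

theorem insertGenerator_left_monOp (p q : ℕ) {n : ℕ} (h : p + q + 1 = n) (i : Fin n) :
    insertGenerator (dupRelators K) .left i (monOp K p q h) =
      if p ≤ (i : ℕ) then monOp K p (q + 1) (by omega) else 0 := by
  obtain ⟨D, hD, hcl⟩ := exists_isKoszulDual_totalClass_eq K
  have hi : (i : ℕ) < p + q + 1 := h ▸ i.2
  have hgraft := (hcl _).trans (hD.evalAt_graft_left (totalClass _ .leaf) hi)
  rw [DuplicialAlgebra.monomial, ← hcl] at hgraft
  refine (comp_treeClass (orthogonal (dupRelators K)) i (rfl : n + 2 = n + 1 + 1)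
    ((leaves_dupMonomial p q).trans h) (s := .node .left .leaf .leaf) rfl).trans ?_
  split_ifs at hgraft ⊢
  · exact treeClass_eq_of_totalClass_eq K _ _ hgraft
  · exact treeClass_eq_zero_of_totalClass_eq K _ hgraft

theorem evalOp_monOp (p q : ℕ) {n : ℕ} (h : p + q + 1 = n) :
    evalOp (isAlgebraOfType_polynomialDuplicial K) (fun _ => 1) n (monOp K p q h) =
      MvPolynomial.X true ^ p * MvPolynomial.X false ^ q :=
  (evalOp_treeClass _ _ _ _).trans (monomial_twistedDuplicial _ _ _ _ p q)

theorem linearIndependent_monOp (n : ℕ) :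
    LinearIndependent K fun p : Fin (n + 1) => monOp K p (n - p) (by omega : _ = n + 1) := by
  refine LinearIndependent.of_comp (R := K)
    (evalOp (isAlgebraOfType_polynomialDuplicial K) (fun _ => 1) (n + 1)) ?_
  refine Eq.subst (motive := fun v => LinearIndependent K v) ?_
    (linearIndependent_X_pow_mul_X_pow K n)
  exact funext fun p => (evalOp_monOp K _ _ _).symm

theorem span_range_monOp (n : ℕ) :
    Submodule.span K (Set.range fun p : Fin (n + 1) => monOp K p (n - p) (by omega : _ = n + 1)) =
      ⊤ := by
  suffices h : ∀ (t : PTree DupGen) (ht : t.leaves = n + 1),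
      treeClass (orthogonal (dupRelators K)) t ht ∈ Submodule.span K
        (Set.range fun p : Fin (n + 1) => monOp K p (n - p) (by omega : _ = n + 1)) from
    top_le_iff.1 ((span_range_treeClass (orthogonal (dupRelators K)) (n + 1)).ge.trans
      (Submodule.span_le.2 (Set.range_subset_iff.2 fun t => h t.1 t.2)))
  intro t ht
  rcases treeClass_eq_zero_or_eq_monOp K t ht with h | ⟨p, q, hpq, h⟩
  · exact (congrArg (· ∈ _) h).mpr (zero_mem _)
  · obtain rfl : q = n - p := by omega
    exact (congrArg (· ∈ _) h).mpr (Submodule.subset_span ⟨⟨p, by omega⟩, rfl⟩)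

/-- The basis of `Dup^!_{n+1}` formed by the monomials `x ≻ ⋯ ≻ x ≺ ⋯ ≺ x`. -/
def monBasis (n : ℕ) : Module.Basis (Fin (n + 1)) K ((koszulDual (dupRelators K)).Op (n + 1)) :=
  .mk (linearIndependent_monOp K n) (span_range_monOp K n).ge

theorem monBasis_apply (n : ℕ) (p : Fin (n + 1)) :
    monBasis K n p = monOp K p (n - p) (by omega) :=
  Module.Basis.mk_apply _ _ _

end DualBasis

/-! ### Tensor powers and their faces -/

section TensorPowers

variable {K : Type u} [Field K] {A : Type w} [AddCommGroup A] [Module K A]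

/-- The map `a, u ↦ a ⊗ u` on tensor powers. -/
def tcons (k : ℕ) : A →ₗ[K] (⨂[K] _ : Fin k, A) →ₗ[K] ⨂[K] _ : Fin (k + 1), A :=
  (PiTensorProduct.lift (R := K) (s := fun _ : Fin k => A)
      (E := ⨂[K] _ : Fin (k + 1), A)).toLinearMap ∘ₗ
    (PiTensorProduct.tprod K (s := fun _ : Fin (k + 1) => A)).curryLeft

theorem tcons_tprod (k : ℕ) (a : A) (v : Fin k → A) :
    tcons k a (PiTensorProduct.tprod K v) =
      PiTensorProduct.tprod K (Fin.cons a v : Fin (k + 1) → A) := by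
  simp [tcons]

theorem tprod_eq_tcons (k : ℕ) (v : Fin (k + 1) → A) :
    PiTensorProduct.tprod K v = tcons k (v 0) (PiTensorProduct.tprod K (Fin.tail v)) := by
  rw [tcons_tprod, Fin.cons_self_tail]

variable {N : Type v} [AddCommGroup N] [Module K N]

theorem tensorPower_hom_ext {k : ℕ} {f g : (⨂[K] _ : Fin (k + 1), A) →ₗ[K] N}
    (h : ∀ a u, f (tcons k a u) = g (tcons k a u)) : f = g := by
  refine PiTensorProduct.ext (MultilinearMap.ext fun v => ?_)
  simp only [LinearMap.compMultilinearMap_apply, tprod_eq_tcons, h]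

theorem tensorPower_hom_ext₂ {k : ℕ} {f g : (⨂[K] _ : Fin (k + 2), A) →ₗ[K] N}
    (h : ∀ a b u, f (tcons (k + 1) a (tcons k b u)) = g (tcons (k + 1) a (tcons k b u))) :
    f = g :=
  tensorPower_hom_ext fun a => LinearMap.congr_fun
    (tensorPower_hom_ext (f := f ∘ₗ tcons (k + 1) a) (g := g ∘ₗ tcons (k + 1) a) (h a))

/-- The linear map defined on a tensor power by its values on the elements `a ⊗ u`. -/
def tuncons (k : ℕ) (β : A →ₗ[K] (⨂[K] _ : Fin k, A) →ₗ[K] N) :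
    (⨂[K] _ : Fin (k + 1), A) →ₗ[K] N :=
  PiTensorProduct.lift (LinearMap.uncurryLeft (M := fun _ : Fin (k + 1) => A)
    ((PiTensorProduct.lift (R := K) (s := fun _ : Fin k => A) (E := N)).symm.toLinearMap ∘ₗ β))

theorem tuncons_tcons (k : ℕ) (β : A →ₗ[K] (⨂[K] _ : Fin k, A) →ₗ[K] N) (a : A)
    (u : ⨂[K] _ : Fin k, A) : tuncons k β (tcons k a u) = β a u := by
  suffices h : tuncons k β ∘ₗ tcons k a = β a from LinearMap.congr_fun h u
  refine PiTensorProduct.ext (MultilinearMap.ext fun v => ?_)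
  simp [tcons_tprod, tuncons]

/-- The map `b ⊗ u ↦ μ(a, b) ⊗ u` on tensor powers. -/
def act (μ : A →ₗ[K] A →ₗ[K] A) (k : ℕ) (a : A) :
    (⨂[K] _ : Fin (k + 1), A) →ₗ[K] ⨂[K] _ : Fin (k + 1), A :=
  tuncons k (tcons k ∘ₗ μ a)

theorem act_tcons (μ : A →ₗ[K] A →ₗ[K] A) (k : ℕ) (a b : A) (u : ⨂[K] _ : Fin k, A) :
    act μ k a (tcons k b u) = tcons k (μ a b) u := by
  rw [act, tuncons_tcons, LinearMap.comp_apply]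

theorem act_act {μ ν : A →ₗ[K] A →ₗ[K] A} {a b : A} (h : ∀ c, μ (ν a b) c = ν a (μ b c)) (k : ℕ)
    (u : ⨂[K] _ : Fin (k + 1), A) : act μ k (ν a b) u = act ν k a (act μ k b u) := by
  suffices h : act μ k (ν a b) = act ν k a ∘ₗ act μ k b from LinearMap.congr_fun h u
  refine tensorPower_hom_ext fun c w => ?_
  simp only [LinearMap.comp_apply, act_tcons, h]

theorem face_tprod (μ : A →ₗ[K] A →ₗ[K] A) {k : ℕ} (i : Fin k) (v : Fin (k + 1) → A) :
    face μ rfl i (PiTensorProduct.tprod K v) = PiTensorProduct.tprod K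
      (Fin.contractNth i.castSucc (fun x y => μ x y) v) :=
  PiTensorProduct.lift.tprod _

theorem face_zero_tcons (μ : A →ₗ[K] A →ₗ[K] A) {k : ℕ} (a : A) (u : ⨂[K] _ : Fin (k + 1), A) :
    face μ rfl (0 : Fin (k + 1)) (tcons (k + 1) a u) = act μ k a u := by
  suffices h : face μ rfl (0 : Fin (k + 1)) ∘ₗ tcons (k + 1) a = act μ k a from
    LinearMap.congr_fun h u
  refine PiTensorProduct.ext (MultilinearMap.ext fun v => ?_)
  rw [LinearMap.compMultilinearMap_apply, LinearMap.compMultilinearMap_apply, LinearMap.comp_apply,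
    tcons_tprod, face_tprod, tprod_eq_tcons k v, act_tcons, tcons_tprod]
  congr 1
  funext j
  refine Fin.cases ?_ (fun j => ?_) j
  · exact Fin.contractNth_apply_of_eq _ _ _ _ rfl
  · exact Fin.contractNth_apply_of_gt _ _ _ _ j.succ_pos

theorem face_succ_tcons (μ : A →ₗ[K] A →ₗ[K] A) {k : ℕ} (i : Fin k) (a : A)
    (u : ⨂[K] _ : Fin (k + 1), A) :
    face μ rfl i.succ (tcons (k + 1) a u) = tcons k a (face μ rfl i u) := by
  suffices h : face μ rfl i.succ ∘ₗ tcons (k + 1) a = tcons k a ∘ₗ face μ rfl i from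
    LinearMap.congr_fun h u
  refine PiTensorProduct.ext (MultilinearMap.ext fun v => ?_)
  simp only [LinearMap.compMultilinearMap_apply, LinearMap.comp_apply, tcons_tprod, face_tprod]
  congr 1
  funext j
  refine Fin.cases ?_ (fun j => ?_) j <;> simp [Fin.contractNth]

/-- The alternating sum of the faces of index less than `p`. -/
def facesBelow (μ : A →ₗ[K] A →ₗ[K] A) (p k : ℕ) :
    (⨂[K] _ : Fin (k + 1), A) →ₗ[K] ⨂[K] _ : Fin k, A :=
  ∑ i : Fin k, if (i : ℕ) < p then (-1 : K) ^ (i : ℕ) • face μ rfl i else 0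

/-- The alternating sum of the faces of index at least `p`. -/
def facesAbove (μ : A →ₗ[K] A →ₗ[K] A) (p k : ℕ) :
    (⨂[K] _ : Fin (k + 1), A) →ₗ[K] ⨂[K] _ : Fin k, A :=
  ∑ i : Fin k, if p ≤ (i : ℕ) then (-1 : K) ^ (i : ℕ) • face μ rfl i else 0

theorem facesBelow_zero (μ : A →ₗ[K] A →ₗ[K] A) (k : ℕ) : facesBelow μ 0 k = 0 := by
  simp [facesBelow]

theorem facesBelow_zero_right (μ : A →ₗ[K] A →ₗ[K] A) (p : ℕ) : facesBelow μ p 0 = 0 := by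
  simp [facesBelow]

theorem facesAbove_zero_right (μ : A →ₗ[K] A →ₗ[K] A) (p : ℕ) : facesAbove μ p 0 = 0 := by
  simp [facesAbove]

theorem facesBelow_succ_tcons (μ : A →ₗ[K] A →ₗ[K] A) (p k : ℕ) (a : A)
    (u : ⨂[K] _ : Fin (k + 1), A) :
    facesBelow μ (p + 1) (k + 1) (tcons (k + 1) a u) =
      act μ k a u - tcons k a (facesBelow μ p k u) := by
  simp only [facesBelow, Fin.sum_univ_succ, LinearMap.add_apply, LinearMap.sum_apply, map_sum,
    sub_eq_add_neg, ← Finset.sum_neg_distrib]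
  congr 1
  · simp [face_zero_tcons]
  · refine Finset.sum_congr rfl fun i _ => ?_
    simp only [Fin.val_succ, Nat.add_lt_add_iff_right]
    split_ifs
    · simp [face_succ_tcons, pow_succ]
    · simp

theorem facesBelow_one_tcons (μ : A →ₗ[K] A →ₗ[K] A) (k : ℕ) (a : A)
    (u : ⨂[K] _ : Fin (k + 1), A) :
    facesBelow μ 1 (k + 1) (tcons (k + 1) a u) = act μ k a u := by
  rw [facesBelow_succ_tcons, facesBelow_zero, LinearMap.zero_apply, map_zero, sub_zero]

theorem facesAbove_succ_tcons (μ : A →ₗ[K] A →ₗ[K] A) (p k : ℕ) (a : A)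
    (u : ⨂[K] _ : Fin (k + 1), A) :
    facesAbove μ (p + 1) (k + 1) (tcons (k + 1) a u) = -tcons k a (facesAbove μ p k u) := by
  simp only [facesAbove, Fin.sum_univ_succ, LinearMap.add_apply, LinearMap.sum_apply, map_sum,
    ← Finset.sum_neg_distrib]
  rw [if_neg (by simp), LinearMap.zero_apply, zero_add]
  refine Finset.sum_congr rfl fun i _ => ?_
  simp only [Fin.val_succ, Nat.add_le_add_iff_right]
  split_ifs
  · simp [face_succ_tcons, pow_succ]
  · simp

theorem facesAbove_zero_tcons (μ : A →ₗ[K] A →ₗ[K] A) (k : ℕ) (a : A)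
    (u : ⨂[K] _ : Fin (k + 1), A) :
    facesAbove μ 0 (k + 1) (tcons (k + 1) a u) =
      act μ k a u - tcons k a (facesAbove μ 0 k u) := by
  simp only [facesAbove, Fin.sum_univ_succ, LinearMap.add_apply, LinearMap.sum_apply, map_sum,
    sub_eq_add_neg, ← Finset.sum_neg_distrib, Nat.zero_le, if_true]
  congr 1
  · simp [face_zero_tcons]
  · refine Finset.sum_congr rfl fun i _ => ?_
    simp [face_succ_tcons, pow_succ]

/-! ### The bicomplex relations -/

theorem facesBelow_succ_act {μ ν : A →ₗ[K] A →ₗ[K] A} {a : A}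
    (h : ∀ b c, μ (ν a b) c = ν a (μ b c)) (p k : ℕ) (u : ⨂[K] _ : Fin (k + 2), A) :
    facesBelow μ (p + 1) (k + 1) (act ν (k + 1) a u) =
      act ν k a (facesBelow μ (p + 1) (k + 1) u) := by
  suffices h : facesBelow μ (p + 1) (k + 1) ∘ₗ act ν (k + 1) a =
      act ν k a ∘ₗ facesBelow μ (p + 1) (k + 1) from LinearMap.congr_fun h u
  refine tensorPower_hom_ext fun b w => ?_
  simp only [LinearMap.comp_apply, act_tcons, facesBelow_succ_tcons, map_sub, act_act (h b)]

theorem facesAbove_zero_act {μ ν : A →ₗ[K] A →ₗ[K] A} {a : A}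
    (h : ∀ b c, μ (ν a b) c = ν a (μ b c)) (k : ℕ) (u : ⨂[K] _ : Fin (k + 2), A) :
    facesAbove μ 0 (k + 1) (act ν (k + 1) a u) = act ν k a (facesAbove μ 0 (k + 1) u) := by
  suffices h : facesAbove μ 0 (k + 1) ∘ₗ act ν (k + 1) a =
      act ν k a ∘ₗ facesAbove μ 0 (k + 1) from LinearMap.congr_fun h u
  refine tensorPower_hom_ext fun b w => ?_
  simp only [LinearMap.comp_apply, act_tcons, facesAbove_zero_tcons, map_sub, act_act (h b)]

theorem facesAbove_succ_act (μ ν : A →ₗ[K] A →ₗ[K] A) (a : A) (p k : ℕ)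
    (u : ⨂[K] _ : Fin (k + 2), A) :
    facesAbove μ (p + 1) (k + 1) (act ν (k + 1) a u) =
      act ν k a (facesAbove μ (p + 1) (k + 1) u) := by
  suffices h : facesAbove μ (p + 1) (k + 1) ∘ₗ act ν (k + 1) a =
      act ν k a ∘ₗ facesAbove μ (p + 1) (k + 1) from LinearMap.congr_fun h u
  refine tensorPower_hom_ext fun b w => ?_
  simp only [LinearMap.comp_apply, act_tcons, facesAbove_succ_tcons, map_neg]

theorem facesBelow_facesBelow {μ : A →ₗ[K] A →ₗ[K] A} (hμ : ∀ x y z, μ (μ x y) z = μ x (μ y z))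
    (p k : ℕ) : facesBelow μ p k ∘ₗ facesBelow μ (p + 1) (k + 1) = 0 := by
  induction p generalizing k with
  | zero => rw [facesBelow_zero, LinearMap.zero_comp]
  | succ p ih =>
    rcases k with _ | k
    · rw [facesBelow_zero_right, LinearMap.zero_comp]
    refine tensorPower_hom_ext fun a u => ?_
    have hu := LinearMap.congr_fun (ih k) u
    rw [LinearMap.comp_apply, LinearMap.zero_apply] at hu ⊢
    rw [facesBelow_succ_tcons, map_sub, facesBelow_succ_tcons μ p, hu, map_zero, sub_zero,
      facesBelow_succ_act (hμ a), sub_self]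

theorem facesAbove_facesAbove {μ : A →ₗ[K] A →ₗ[K] A} (hμ : ∀ x y z, μ (μ x y) z = μ x (μ y z))
    (p k : ℕ) : facesAbove μ p k ∘ₗ facesAbove μ p (k + 1) = 0 := by
  induction k generalizing p with
  | zero => rw [facesAbove_zero_right, LinearMap.zero_comp]
  | succ k ih =>
    refine tensorPower_hom_ext fun a u => ?_
    rcases p with _ | p
    · have hu := LinearMap.congr_fun (ih 0) u
      rw [LinearMap.comp_apply, LinearMap.zero_apply] at hu ⊢
      rw [facesAbove_zero_tcons, map_sub, facesAbove_zero_tcons μ k a, hu, map_zero, sub_zero,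
        facesAbove_zero_act (hμ a), sub_self]
    · have hu := LinearMap.congr_fun (ih p) u
      rw [LinearMap.comp_apply, LinearMap.zero_apply] at hu ⊢
      rw [facesAbove_succ_tcons, map_neg, facesAbove_succ_tcons, hu, map_zero, neg_zero, neg_zero]

theorem facesBelow_facesAbove (D : DuplicialAlgebra K A) (p k : ℕ) :
    facesBelow D.right (p + 1) k ∘ₗ facesAbove D.left (p + 1) (k + 1) +
      facesAbove D.left p k ∘ₗ facesBelow D.right (p + 1) (k + 1) = 0 := by
  induction p generalizing k with
  | zero =>
    rcases k with _ | k
    · rw [facesBelow_zero_right, facesAbove_zero_right, LinearMap.zero_comp, LinearMap.zero_comp,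
        add_zero]
    refine tensorPower_hom_ext fun a u => ?_
    rw [LinearMap.add_apply, LinearMap.comp_apply, LinearMap.comp_apply, facesBelow_one_tcons,
      facesAbove_succ_tcons, map_neg, facesBelow_one_tcons, facesAbove_zero_act (D.right_left a),
      neg_add_cancel, LinearMap.zero_apply]
  | succ p ih =>
    rcases k with _ | k
    · rw [facesBelow_zero_right, facesAbove_zero_right, LinearMap.zero_comp, LinearMap.zero_comp,
        add_zero]
    refine tensorPower_hom_ext fun a u => ?_
    have hu := LinearMap.congr_fun (ih k) u
    simp only [LinearMap.add_apply, LinearMap.comp_apply, LinearMap.zero_apply] at hu ⊢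
    rw [facesBelow_succ_tcons, facesAbove_succ_tcons, map_neg, map_sub, facesAbove_succ_act,
      facesBelow_succ_tcons, facesAbove_succ_tcons, eq_neg_of_add_eq_zero_left hu, map_neg]
    abel

end TensorPowers

/-! ### The contracting homotopy -/

section Contractions

variable {K : Type u} [Field K] {A : Type w} [AddCommGroup A] [Module K A] {N : Type v}
  [AddCommGroup N] [Module K N]

/-- The map `x ⊗ y, w ↦ x ⊗ y ⊗ w` on tensor powers. -/
def tcons₂ (k : ℕ) : A ⊗[K] A →ₗ[K] (⨂[K] _ : Fin k, A) →ₗ[K] ⨂[K] _ : Fin (k + 2), A :=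
  TensorProduct.lift ((LinearMap.llcomp K _ _ _ ∘ₗ tcons (k + 1)).compl₂ (tcons k))

theorem tcons₂_tmul (k : ℕ) (x y : A) (w : ⨂[K] _ : Fin k, A) :
    tcons₂ k (x ⊗ₜ[K] y) w = tcons (k + 1) x (tcons k y w) := by
  simp [tcons₂]

theorem act_tcons₂ (μ : A →ₗ[K] A →ₗ[K] A) (k : ℕ) (a : A) (m : A ⊗[K] A)
    (w : ⨂[K] _ : Fin k, A) :
    act μ (k + 1) a (tcons₂ k m w) = tcons₂ k (LinearMap.rTensor A (μ a) m) w := by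
  induction m using TensorProduct.induction_on with
  | zero => simp
  | tmul x y => rw [LinearMap.rTensor_tmul, tcons₂_tmul, tcons₂_tmul, act_tcons]
  | add x y hx hy => simp only [map_add, LinearMap.add_apply, hx, hy]

theorem facesBelow_one_tcons₂ (μ : A →ₗ[K] A →ₗ[K] A) (k : ℕ) (m : A ⊗[K] A)
    (w : ⨂[K] _ : Fin k, A) :
    facesBelow μ 1 (k + 1) (tcons₂ k m w) = tcons k (TensorProduct.lift μ m) w := by
  induction m using TensorProduct.induction_on with
  | zero => simp
  | tmul x y => rw [tcons₂_tmul, facesBelow_one_tcons, act_tcons, TensorProduct.lift.tmul]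
  | add x y hx hy => simp only [map_add, LinearMap.add_apply, hx, hy]

theorem facesAbove_one_tcons₂ (μ : A →ₗ[K] A →ₗ[K] A) (k : ℕ) (m : A ⊗[K] A) (b : A)
    (w : ⨂[K] _ : Fin k, A) :
    facesAbove μ 1 (k + 2) (tcons₂ (k + 1) m (tcons k b w)) =
      tcons₂ k m (facesAbove μ 0 k (tcons k b w)) -
        tcons₂ k (LinearMap.lTensor A (μ.flip b) m) w := by
  induction m using TensorProduct.induction_on with
  | zero => simp
  | tmul x y =>
    rw [tcons₂_tmul, facesAbove_succ_tcons, facesAbove_zero_tcons, act_tcons, map_sub, neg_sub,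
      LinearMap.lTensor_tmul, tcons₂_tmul, tcons₂_tmul, LinearMap.flip_apply]
  | add x y hx hy =>
    simp only [map_add, LinearMap.add_apply, hx, hy]
    abel

theorem facesAbove_zero_tcons₂ (μ : A →ₗ[K] A →ₗ[K] A) (k : ℕ) (m : A ⊗[K] A)
    (w : ⨂[K] _ : Fin k, A) :
    facesAbove μ 0 (k + 1) (tcons₂ k m w) =
      tcons k (TensorProduct.lift μ m) w + facesAbove μ 1 (k + 1) (tcons₂ k m w) := by
  induction m using TensorProduct.induction_on with
  | zero => simp
  | tmul x y =>
    rw [tcons₂_tmul, facesAbove_succ_tcons, facesAbove_zero_tcons, act_tcons,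
      TensorProduct.lift.tmul, sub_eq_add_neg]
  | add x y hx hy =>
    simp only [map_add, LinearMap.add_apply, hx, hy]
    abel

/-- The map which applies `σ` to the factor with index `p`, with the sign `(-1) ^ p`; it is zero
when there is no such factor. -/
def applyAt (σ : A →ₗ[K] A ⊗[K] A) : ∀ _ k : ℕ,
    (⨂[K] _ : Fin (k + 1), A) →ₗ[K] ⨂[K] _ : Fin (k + 2), A
  | 0, k => tuncons k (tcons₂ k ∘ₗ σ)
  | _ + 1, 0 => 0
  | p + 1, k + 1 => -tuncons (k + 1) ((tcons (k + 2)).compl₂ (applyAt σ p k))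

theorem applyAt_zero_tcons (σ : A →ₗ[K] A ⊗[K] A) (k : ℕ) (a : A) (w : ⨂[K] _ : Fin k, A) :
    applyAt σ 0 k (tcons k a w) = tcons₂ k (σ a) w := by
  rw [applyAt, tuncons_tcons, LinearMap.comp_apply]

theorem applyAt_succ_tcons (σ : A →ₗ[K] A ⊗[K] A) (p k : ℕ) (a : A)
    (u : ⨂[K] _ : Fin (k + 1), A) :
    applyAt σ (p + 1) (k + 1) (tcons (k + 1) a u) = -tcons (k + 2) a (applyAt σ p k u) := by
  rw [applyAt, LinearMap.neg_apply, tuncons_tcons, LinearMap.compl₂_apply]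

theorem applyAt_succ_act (σ : A →ₗ[K] A ⊗[K] A) (μ : A →ₗ[K] A →ₗ[K] A) (p k : ℕ) (a : A)
    (u : ⨂[K] _ : Fin (k + 2), A) :
    applyAt σ (p + 1) (k + 1) (act μ (k + 1) a u) =
      act μ (k + 2) a (applyAt σ (p + 1) (k + 1) u) := by
  suffices h : applyAt σ (p + 1) (k + 1) ∘ₗ act μ (k + 1) a =
      act μ (k + 2) a ∘ₗ applyAt σ (p + 1) (k + 1) from LinearMap.congr_fun h u
  refine tensorPower_hom_ext fun b w => ?_
  simp only [LinearMap.comp_apply, act_tcons, applyAt_succ_tcons, map_neg]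

/-- The data which contract the operadic chain complex of a duplicial algebra `A` onto a space of
generators `N`: `splitRight` and `splitLeft` split off the last factor of the products `x ≻ y`
and, modulo the image of `≻`, of the products `x ≺ y`. -/
structure Contraction (D : DuplicialAlgebra K A) (ι : N →ₗ[K] A) (π : A →ₗ[K] N) where
  splitRight : A →ₗ[K] A ⊗[K] A
  splitLeft : A →ₗ[K] A ⊗[K] A
  decomp : ∀ x, TensorProduct.lift D.right (splitRight x) +
    TensorProduct.lift D.left (splitLeft x) + ι (π x) = x
  splitRight_right : ∀ x y, splitRight (D.right x y) =
    LinearMap.rTensor A (D.right x) (splitRight y) +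
      x ⊗ₜ[K] (y - TensorProduct.lift D.right (splitRight y))
  splitRight_left : ∀ x y, splitRight (D.left x y) =
    LinearMap.lTensor A (D.left.flip y) (splitRight x)
  splitLeft_right : ∀ x y, splitLeft (D.right x y) = 0
  splitLeft_left : ∀ x y, splitLeft (D.left x y) =
    LinearMap.lTensor A (D.left.flip y) (splitLeft x) + ι (π x) ⊗ₜ[K] y
  proj_right : ∀ x y, π (D.right x y) = 0
  proj_left : ∀ x y, π (D.left x y) = 0

namespace Contraction

variable {D : DuplicialAlgebra K A} {ι : N →ₗ[K] A} {π : A →ₗ[K] N} (c : Contraction D ι π)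

theorem facesBelow_comp_applyAt_add {p k : ℕ} (hp : p ≤ k) :
    facesBelow D.right (p + 2) (k + 2) ∘ₗ applyAt c.splitRight (p + 1) (k + 1) +
      applyAt c.splitRight p k ∘ₗ facesBelow D.right (p + 1) (k + 1) = LinearMap.id := by
  induction p generalizing k with
  | zero =>
    refine tensorPower_hom_ext₂ fun a b w => ?_
    rw [LinearMap.add_apply, LinearMap.comp_apply, LinearMap.comp_apply, LinearMap.id_apply,
      applyAt_succ_tcons, applyAt_zero_tcons, map_neg, facesBelow_succ_tcons, act_tcons₂,
      facesBelow_one_tcons₂, facesBelow_one_tcons, act_tcons, applyAt_zero_tcons,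
      c.splitRight_right, map_add, LinearMap.add_apply, tcons₂_tmul, map_sub, LinearMap.sub_apply,
      map_sub]
    abel
  | succ p ih =>
    obtain ⟨k, rfl⟩ : ∃ k', k = k' + 1 := ⟨k - 1, by omega⟩
    refine tensorPower_hom_ext fun a u => ?_
    have hu := LinearMap.congr_fun (ih (k := k) (by omega)) u
    simp only [LinearMap.add_apply, LinearMap.comp_apply, LinearMap.id_apply] at hu ⊢
    conv_rhs => rw [← hu]
    rw [applyAt_succ_tcons, map_neg, facesBelow_succ_tcons, facesBelow_succ_tcons, map_sub,
      applyAt_succ_act, applyAt_succ_tcons, map_add]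
    abel

theorem facesAbove_comp_applyAt_add {p k : ℕ} (hp : p ≤ k) :
    facesAbove D.left (p + 1) (k + 2) ∘ₗ applyAt c.splitRight p (k + 1) +
      applyAt c.splitRight p k ∘ₗ facesAbove D.left p (k + 1) = 0 := by
  induction p generalizing k with
  | zero =>
    refine tensorPower_hom_ext₂ fun a b w => ?_
    rw [LinearMap.add_apply, LinearMap.comp_apply, LinearMap.comp_apply, LinearMap.zero_apply,
      applyAt_zero_tcons, facesAbove_one_tcons₂, facesAbove_zero_tcons, act_tcons, map_sub,
      applyAt_zero_tcons, applyAt_zero_tcons, c.splitRight_left]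
    abel
  | succ p ih =>
    obtain ⟨k, rfl⟩ : ∃ k', k = k' + 1 := ⟨k - 1, by omega⟩
    refine tensorPower_hom_ext fun a u => ?_
    have hu := LinearMap.congr_fun (ih (k := k) (by omega)) u
    simp only [LinearMap.add_apply, LinearMap.comp_apply, LinearMap.zero_apply] at hu ⊢
    rw [applyAt_succ_tcons, map_neg, facesAbove_succ_tcons, facesAbove_succ_tcons, map_neg,
      applyAt_succ_tcons, neg_neg, neg_neg, ← map_add, hu, map_zero]

theorem applyAt_comp_facesBelow_one (k : ℕ) :
    applyAt c.splitLeft 0 k ∘ₗ facesBelow D.right 1 (k + 1) = 0 := by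
  refine tensorPower_hom_ext₂ fun a b w => ?_
  rw [LinearMap.comp_apply, facesBelow_one_tcons, act_tcons, applyAt_zero_tcons,
    c.splitLeft_right, map_zero, LinearMap.zero_apply, LinearMap.zero_apply]

theorem faces_comp_applyAt_zero_add (k : ℕ) :
    facesBelow D.right 1 (k + 2) ∘ₗ applyAt c.splitRight 0 (k + 1) +
      facesAbove D.left 0 (k + 2) ∘ₗ applyAt c.splitLeft 0 (k + 1) +
        applyAt c.splitLeft 0 k ∘ₗ facesAbove D.left 0 (k + 1) = LinearMap.id := by
  refine tensorPower_hom_ext₂ fun a b w => ?_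
  simp only [LinearMap.add_apply, LinearMap.comp_apply, LinearMap.id_apply]
  conv_rhs => rw [← c.decomp a]
  rw [applyAt_zero_tcons, applyAt_zero_tcons, facesBelow_one_tcons₂, facesAbove_zero_tcons₂,
    facesAbove_one_tcons₂, facesAbove_zero_tcons, act_tcons, map_sub, applyAt_zero_tcons,
    applyAt_zero_tcons, c.splitLeft_left, map_add, LinearMap.add_apply, tcons₂_tmul, map_add,
    map_add, LinearMap.add_apply, LinearMap.add_apply]
  abel

theorem faces_applyAt_zero_tcons_zero (a : A) (w : ⨂[K] _ : Fin 0, A) :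
    facesBelow D.right 1 1 (applyAt c.splitRight 0 0 (tcons 0 a w)) +
      facesAbove D.left 0 1 (applyAt c.splitLeft 0 0 (tcons 0 a w)) + tcons 0 (ι (π a)) w =
      tcons 0 a w := by
  conv_rhs => rw [← c.decomp a]
  have h : facesAbove D.left 1 1 = 0 := by simp [facesAbove]
  rw [applyAt_zero_tcons, applyAt_zero_tcons, facesBelow_one_tcons₂, facesAbove_zero_tcons₂, h,
    LinearMap.zero_apply, add_zero, map_add, map_add, LinearMap.add_apply, LinearMap.add_apply]

end Contraction

end Contractions

/-! ### The total complex -/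

section TotalComplex

variable {K : Type u} [Field K] {A : Type w} [AddCommGroup A] [Module K A]

/-- The differential of the total complex of the bicomplex of a duplicial algebra, the component of
bidegree `(p, n - p)` being indexed by `p`. -/
def totDiff (D : DuplicialAlgebra K A) (n : ℕ) : (Fin (n + 2) → ⨂[K] _ : Fin (n + 2), A) →ₗ[K]
    (Fin (n + 1) → ⨂[K] _ : Fin (n + 1), A) :=
  LinearMap.pi fun p => facesBelow D.right (p + 1) (n + 1) ∘ₗ LinearMap.proj p.succ +
    facesAbove D.left p (n + 1) ∘ₗ LinearMap.proj p.castSucc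

theorem totDiff_apply (D : DuplicialAlgebra K A) (n : ℕ)
    (x : Fin (n + 2) → ⨂[K] _ : Fin (n + 2), A) (p : Fin (n + 1)) :
    totDiff D n x p = facesBelow D.right (p + 1) (n + 1) (x p.succ) +
      facesAbove D.left p (n + 1) (x p.castSucc) := rfl

theorem totDiff_comp_totDiff (D : DuplicialAlgebra K A) (n : ℕ) :
    totDiff D n ∘ₗ totDiff D (n + 1) = 0 := by
  refine LinearMap.ext fun x => funext fun p => ?_
  have hright := LinearMap.congr_fun (facesBelow_facesBelow D.right_right (p + 1) (n + 1))
    (x p.succ.succ)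
  have hleft := LinearMap.congr_fun (facesAbove_facesAbove D.left_left p (n + 1))
    (x p.castSucc.castSucc)
  have hmixed := LinearMap.congr_fun (facesBelow_facesAbove D p (n + 1)) (x p.castSucc.succ)
  simp only [LinearMap.comp_apply, LinearMap.add_apply, LinearMap.zero_apply,
    Fin.succ_castSucc] at hright hleft hmixed
  rw [LinearMap.comp_apply, totDiff_apply, totDiff_apply, totDiff_apply, Fin.succ_castSucc,
    map_add, map_add, Fin.val_succ, Fin.val_castSucc, hright, hleft, zero_add, add_zero]
  exact hmixed

theorem subsingletonEquiv_tcons (a : A) :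
    PiTensorProduct.subsingletonEquiv (0 : Fin 1)
      (tcons 0 a (PiTensorProduct.tprod K Fin.elim0)) = a := by
  rw [tcons_tprod, PiTensorProduct.subsingletonEquiv_apply_tprod, Fin.cons_zero]

theorem tcons_subsingletonEquiv (u : ⨂[K] _ : Fin 1, A) :
    tcons 0 (PiTensorProduct.subsingletonEquiv (0 : Fin 1) u) (PiTensorProduct.tprod K Fin.elim0) =
      u :=
  (PiTensorProduct.subsingletonEquiv (R := K) (s := fun _ : Fin 1 => A) 0).injective
    (subsingletonEquiv_tcons _)

variable {N : Type v} [AddCommGroup N] [Module K N]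

/-- The augmentation of the total complex induced by a map `A → N`. -/
def totAugmentation (π : A →ₗ[K] N) : (Fin 1 → ⨂[K] _ : Fin 1, A) →ₗ[K] N :=
  π ∘ₗ (PiTensorProduct.subsingletonEquiv (0 : Fin 1)).toLinearMap ∘ₗ LinearMap.proj 0

namespace Contraction

variable {D : DuplicialAlgebra K A} {ι : N →ₗ[K] A} {π : A →ₗ[K] N} (c : Contraction D ι π)

/-- The contracting homotopy of the total complex. -/
def homotopy (n : ℕ) :
    (Fin (n + 1) → ⨂[K] _ : Fin (n + 1), A) →ₗ[K] (Fin (n + 2) → ⨂[K] _ : Fin (n + 2), A) :=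
  LinearMap.pi (Fin.cons (applyAt c.splitLeft 0 n ∘ₗ LinearMap.proj 0) fun p =>
    applyAt c.splitRight p n ∘ₗ LinearMap.proj p)

theorem homotopy_apply_zero (n : ℕ) (x : Fin (n + 1) → ⨂[K] _ : Fin (n + 1), A) :
    c.homotopy n x 0 = applyAt c.splitLeft 0 n (x 0) := rfl

theorem homotopy_apply_succ (n : ℕ) (x : Fin (n + 1) → ⨂[K] _ : Fin (n + 1), A)
    (p : Fin (n + 1)) : c.homotopy n x p.succ = applyAt c.splitRight p n (x p) := rfl

theorem totDiff_homotopy (n : ℕ) (x : Fin (n + 2) → ⨂[K] _ : Fin (n + 2), A) :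
    totDiff D (n + 1) (c.homotopy (n + 1) x) + c.homotopy n (totDiff D n x) = x := by
  funext p
  rw [Pi.add_apply, totDiff_apply, homotopy_apply_succ]
  refine Fin.cases ?_ (fun p => ?_) p
  · have hid := LinearMap.congr_fun (c.faces_comp_applyAt_zero_add n) (x 0)
    have hzero := LinearMap.congr_fun (c.applyAt_comp_facesBelow_one n) (x 1)
    simp only [LinearMap.add_apply, LinearMap.comp_apply, LinearMap.id_apply,
      LinearMap.zero_apply] at hid hzero
    rw [Fin.castSucc_zero, homotopy_apply_zero, homotopy_apply_zero, totDiff_apply, map_add,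
      Fin.val_zero, Fin.val_zero, zero_add, Fin.succ_zero_eq_one, hzero, zero_add,
      Fin.castSucc_zero]
    exact hid
  · have hid := LinearMap.congr_fun (c.facesBelow_comp_applyAt_add (Nat.le_of_lt_succ p.2))
      (x p.succ)
    have hzero := LinearMap.congr_fun (c.facesAbove_comp_applyAt_add (Nat.le_of_lt_succ p.2))
      (x p.castSucc)
    simp only [LinearMap.add_apply, LinearMap.comp_apply, LinearMap.id_apply,
      LinearMap.zero_apply] at hid hzero
    rw [← Fin.succ_castSucc, homotopy_apply_succ, homotopy_apply_succ, totDiff_apply, map_add,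
      Fin.val_succ, Fin.val_castSucc, add_add_add_comm, hzero, add_zero]
    exact hid

include c

theorem exact_totDiff (n : ℕ) : Function.Exact (totDiff D (n + 1)) (totDiff D n) := by
  refine fun x => ⟨fun hx => ⟨c.homotopy (n + 1) x, ?_⟩, ?_⟩
  · simpa only [hx, map_zero, add_zero] using c.totDiff_homotopy n x
  · rintro ⟨y, rfl⟩
    exact LinearMap.congr_fun (totDiff_comp_totDiff D n) y

theorem totAugmentation_comp_totDiff : totAugmentation π ∘ₗ totDiff D 0 = 0 := by
  have hright : π ∘ₗ (PiTensorProduct.subsingletonEquiv (0 : Fin 1)).toLinearMap ∘ₗ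
      facesBelow D.right 1 1 = 0 := by
    refine tensorPower_hom_ext fun a u => ?_
    rw [LinearMap.comp_apply, LinearMap.comp_apply, facesBelow_one_tcons,
      ← tcons_subsingletonEquiv u, act_tcons, LinearEquiv.coe_coe, subsingletonEquiv_tcons,
      c.proj_right, LinearMap.zero_apply]
  have hleft : π ∘ₗ (PiTensorProduct.subsingletonEquiv (0 : Fin 1)).toLinearMap ∘ₗ
      facesAbove D.left 0 1 = 0 := by
    refine tensorPower_hom_ext fun a u => ?_
    rw [LinearMap.comp_apply, LinearMap.comp_apply, facesAbove_zero_tcons, facesAbove_zero_right,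
      LinearMap.zero_apply, map_zero, sub_zero, ← tcons_subsingletonEquiv u, act_tcons,
      LinearEquiv.coe_coe, subsingletonEquiv_tcons, c.proj_left, LinearMap.zero_apply]
  refine LinearMap.ext fun y => ?_
  change (π ∘ₗ (PiTensorProduct.subsingletonEquiv (0 : Fin 1)).toLinearMap)
    (facesBelow D.right 1 1 (y 1) + facesAbove D.left 0 1 (y 0)) = 0
  rw [map_add]
  exact (congrArg₂ (· + ·) (LinearMap.congr_fun hright (y 1))
    (LinearMap.congr_fun hleft (y 0))).trans (add_zero 0)

theorem exact_totDiff_totAugmentation : Function.Exact (totDiff D 0) (totAugmentation π) := by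
  refine fun x => ⟨fun hx => ⟨c.homotopy 0 x, funext fun p => ?_⟩, ?_⟩
  · obtain rfl : p = 0 := Fin.fin_one_eq_zero p
    have hπ : π (PiTensorProduct.subsingletonEquiv (0 : Fin 1) (x 0)) = 0 := hx
    have h := c.faces_applyAt_zero_tcons_zero
      (PiTensorProduct.subsingletonEquiv (0 : Fin 1) (x 0)) (PiTensorProduct.tprod K Fin.elim0)
    rw [hπ, map_zero, map_zero, LinearMap.zero_apply, add_zero, tcons_subsingletonEquiv] at h
    rw [totDiff_apply]
    exact h
  · rintro ⟨y, rfl⟩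
    exact LinearMap.congr_fun c.totAugmentation_comp_totDiff y

end Contraction

end TotalComplex

/-! ### Contractions of free duplicial algebras -/

section Extensions

variable {K : Type u} [Field K] {A : Type w} [AddCommGroup A] [Module K A]

theorem lift_rTensor {μ : A →ₗ[K] A →ₗ[K] A} {f g : A →ₗ[K] A}
    (h : ∀ a b, μ (f a) b = g (μ a b)) (t : A ⊗[K] A) :
    TensorProduct.lift μ (LinearMap.rTensor A f t) = g (TensorProduct.lift μ t) := by
  suffices TensorProduct.lift μ ∘ₗ LinearMap.rTensor A f = g ∘ₗ TensorProduct.lift μ from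
    LinearMap.congr_fun this t
  exact TensorProduct.ext' h

theorem lift_lTensor {μ : A →ₗ[K] A →ₗ[K] A} {f g : A →ₗ[K] A}
    (h : ∀ a b, μ a (f b) = g (μ a b)) (t : A ⊗[K] A) :
    TensorProduct.lift μ (LinearMap.lTensor A f t) = g (TensorProduct.lift μ t) := by
  suffices TensorProduct.lift μ ∘ₗ LinearMap.lTensor A f = g ∘ₗ TensorProduct.lift μ from
    LinearMap.congr_fun this t
  exact TensorProduct.ext' h

variable (D : DuplicialAlgebra K A)

theorem lift_right_rTensor (x : A) (t : A ⊗[K] A) :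
    TensorProduct.lift D.right (LinearMap.rTensor A (D.right x) t) =
      D.right x (TensorProduct.lift D.right t) :=
  lift_rTensor (fun _ _ => D.right_right x _ _) t

theorem lift_right_lTensor (y : A) (t : A ⊗[K] A) :
    TensorProduct.lift D.right (LinearMap.lTensor A (D.left.flip y) t) =
      D.left (TensorProduct.lift D.right t) y :=
  lift_lTensor (g := D.left.flip y) (fun _ _ => (D.right_left _ _ y).symm) t

theorem lift_left_lTensor (y : A) (t : A ⊗[K] A) :
    TensorProduct.lift D.left (LinearMap.lTensor A (D.left.flip y) t) =
      D.left (TensorProduct.lift D.left t) y :=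
  lift_lTensor (g := D.left.flip y) (fun _ _ => (D.left_left _ _ y).symm) t

theorem lTensor_left_left (y z : A) (t : A ⊗[K] A) :
    LinearMap.lTensor A (D.left.flip z) (LinearMap.lTensor A (D.left.flip y) t) =
      LinearMap.lTensor A (D.left.flip (D.left y z)) t := by
  rw [← LinearMap.lTensor_comp_apply]
  congr 2
  exact LinearMap.ext fun x => D.left_left x y z

theorem rTensor_right_right (x y : A) (t : A ⊗[K] A) :
    LinearMap.rTensor A (D.right x) (LinearMap.rTensor A (D.right y) t) =
      LinearMap.rTensor A (D.right (D.right x y)) t := by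
  rw [← LinearMap.rTensor_comp_apply]
  congr 2
  exact LinearMap.ext fun z => (D.right_right x y z).symm

theorem lTensor_rTensor_comm (f g : A →ₗ[K] A) (t : A ⊗[K] A) :
    LinearMap.lTensor A g (LinearMap.rTensor A f t) =
      LinearMap.rTensor A f (LinearMap.lTensor A g t) :=
  LinearMap.congr_fun
    ((LinearMap.lTensor_comp_rTensor A f g).trans (LinearMap.rTensor_comp_lTensor A f g).symm) t

/-- The duplicial algebra `A × (A ⊗ A)` whose sections over `A` are the maps `σ` such that
`σ (x ≻ y) = x ≻ σ y + x ⊗ (y - μ (σ y))` and `σ (x ≺ y) = σ x ≺ y`, where `μ (x ⊗ y) = x ≻ y`. -/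
def rightExtension : DuplicialAlgebra K (A × A ⊗[K] A) where
  left := LinearMap.mk₂ K
    (fun s t => (D.left s.1 t.1, LinearMap.lTensor A (D.left.flip t.1) s.2))
    (fun s s' t => by simp)
    (fun c s t => by simp)
    (fun s t t' => by simp [LinearMap.lTensor_add])
    (fun c s t => by simp [LinearMap.lTensor_smul])
  right := LinearMap.mk₂ K
    (fun s t => (D.right s.1 t.1, LinearMap.rTensor A (D.right s.1) t.2 +
      s.1 ⊗ₜ[K] (t.1 - TensorProduct.lift D.right t.2)))
    (fun s s' t => by simp [LinearMap.rTensor_add, TensorProduct.add_tmul, add_add_add_comm])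
    (fun c s t => by simp [LinearMap.rTensor_smul, TensorProduct.smul_tmul'])
    (fun s t t' => by simp [add_sub_add_comm, TensorProduct.tmul_add, add_add_add_comm])
    (fun c s t => by simp [← smul_sub])
  left_left x y z := by simp [D.left_left, lTensor_left_left]
  right_left x y z := by simp [D.right_left, lTensor_rTensor_comm, lift_right_lTensor]
  right_right x y z := by simp [D.right_right, rTensor_right_right, lift_right_rTensor]

/-- The duplicial algebra `A × (A ⊗ A)` whose sections over `A` are the maps `θ` such that
`θ (x ≻ y) = 0` and `θ (x ≺ y) = θ x ≺ y + (ρ x - μ (θ x)) ⊗ y`, where `μ (x ⊗ y) = x ≺ y`. -/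
def leftExtension (ρ : A →ₗ[K] A) (hr : ∀ x y, ρ (D.right x y) = 0)
    (hl : ∀ x y, ρ (D.left x y) = D.left (ρ x) y) : DuplicialAlgebra K (A × A ⊗[K] A) where
  left := LinearMap.mk₂ K
    (fun s t => (D.left s.1 t.1, LinearMap.lTensor A (D.left.flip t.1) s.2 +
      (ρ s.1 - TensorProduct.lift D.left s.2) ⊗ₜ[K] t.1))
    (fun s s' t => by simp [add_sub_add_comm, TensorProduct.add_tmul, add_add_add_comm])
    (fun c s t => by simp [← smul_sub, TensorProduct.smul_tmul'])
    (fun s t t' => by simp [LinearMap.lTensor_add, TensorProduct.tmul_add, add_add_add_comm])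
    (fun c s t => by simp [LinearMap.lTensor_smul])
  right := LinearMap.mk₂ K (fun s t => (D.right s.1 t.1, 0))
    (fun s s' t => by simp) (fun c s t => by simp) (fun s t t' => by simp) (fun c s t => by simp)
  left_left x y z := by simp [D.left_left, lTensor_left_left, lift_left_lTensor, hl]
  right_left x y z := by simp [D.right_left, hr]
  right_right x y z := by simp [D.right_right]

variable (K A) in
/-- The duplicial algebra with zero operations. -/
def zeroDuplicial : DuplicialAlgebra K A where
  left := 0
  right := 0
  left_left _ _ _ := rfl
  right_left _ _ _ := rfl
  right_right _ _ _ := rfl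

end Extensions

namespace IsFreeDuplicial

variable {K : Type u} [Field K] {V : Type v} [AddCommGroup V] [Module K V]
  {A : Type (max u v)} [AddCommGroup A] [Module K A] {D : DuplicialAlgebra K A} {ι : V →ₗ[K] A}

theorem hom_ext (hD : IsFreeDuplicial D ι) {B : Type (max u v)} [AddCommGroup B]
    [Module K B] (D' : DuplicialAlgebra K B) {f g : A →ₗ[K] B} (hf : IsDuplicialHom D D' f)
    (hg : IsDuplicialHom D D' g) (h : f ∘ₗ ι = g ∘ₗ ι) : f = g :=
  (hD B D' (g ∘ₗ ι)).unique ⟨hf, h⟩ ⟨hg, rfl⟩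

theorem exists_section (hD : IsFreeDuplicial D ι) (D' : DuplicialAlgebra K (A × A ⊗[K] A))
    (hl : ∀ x y, (D'.left x y).1 = D.left x.1 y.1)
    (hr : ∀ x y, (D'.right x y).1 = D.right x.1 y.1) :
    ∃ σ : A →ₗ[K] A ⊗[K] A, (∀ v, σ (ι v) = 0) ∧
      (∀ x y, σ (D.left x y) = (D'.left (x, σ x) (y, σ y)).2) ∧
      ∀ x y, σ (D.right x y) = (D'.right (x, σ x) (y, σ y)).2 := by
  obtain ⟨g, ⟨⟨hgl, hgr⟩, hg⟩, -⟩ := hD _ D' (LinearMap.prod ι 0)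
  have hfst : LinearMap.fst K A (A ⊗[K] A) ∘ₗ g = LinearMap.id := by
    refine hD.hom_ext D ⟨fun x y => ?_, fun x y => ?_⟩ ⟨fun _ _ => rfl, fun _ _ => rfl⟩ ?_
    · exact (congrArg Prod.fst (hgl x y)).trans (hl _ _)
    · exact (congrArg Prod.fst (hgr x y)).trans (hr _ _)
    · rw [LinearMap.comp_assoc, hg, LinearMap.fst_prod, LinearMap.id_comp]
  have hsec (x : A) : (x, (g x).2) = g x := Prod.ext (LinearMap.congr_fun hfst x).symm rfl
  refine ⟨LinearMap.snd K A (A ⊗[K] A) ∘ₗ g, fun v => ?_, fun x y => ?_, fun x y => ?_⟩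
  · exact congrArg Prod.snd (LinearMap.congr_fun hg v)
  · simp only [LinearMap.comp_apply, LinearMap.snd_apply, hsec, hgl]
  · simp only [LinearMap.comp_apply, LinearMap.snd_apply, hsec, hgr]

theorem exists_splitRight (hD : IsFreeDuplicial D ι) :
    ∃ σ : A →ₗ[K] A ⊗[K] A, (∀ v, σ (ι v) = 0) ∧
      (∀ x y, σ (D.left x y) = LinearMap.lTensor A (D.left.flip y) (σ x)) ∧
      ∀ x y, σ (D.right x y) = LinearMap.rTensor A (D.right x) (σ y) +
        x ⊗ₜ[K] (y - TensorProduct.lift D.right (σ y)) :=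
  hD.exists_section (rightExtension D) (fun _ _ => rfl) fun _ _ => rfl

theorem exists_splitLeft (hD : IsFreeDuplicial D ι) {ρ : A →ₗ[K] A}
    (hr : ∀ x y, ρ (D.right x y) = 0) (hl : ∀ x y, ρ (D.left x y) = D.left (ρ x) y) :
    ∃ θ : A →ₗ[K] A ⊗[K] A, (∀ v, θ (ι v) = 0) ∧
      (∀ x y, θ (D.left x y) = LinearMap.lTensor A (D.left.flip y) (θ x) +
        (ρ x - TensorProduct.lift D.left (θ x)) ⊗ₜ[K] y) ∧
      ∀ x y, θ (D.right x y) = 0 :=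
  hD.exists_section (leftExtension D ρ hr hl) (fun _ _ => rfl) fun _ _ => rfl

theorem hom_ext_of_eq_zero (hD : IsFreeDuplicial D ι) {B : Type (max u v)} [AddCommGroup B]
    [Module K B] {f g : A →ₗ[K] B} (hfl : ∀ x y, f (D.left x y) = 0)
    (hfr : ∀ x y, f (D.right x y) = 0) (hgl : ∀ x y, g (D.left x y) = 0)
    (hgr : ∀ x y, g (D.right x y) = 0) (h : f ∘ₗ ι = g ∘ₗ ι) : f = g :=
  hD.hom_ext (zeroDuplicial K B) ⟨hfl, hfr⟩ ⟨hgl, hgr⟩ h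

theorem exists_proj (hD : IsFreeDuplicial D ι) :
    ∃ π : A →ₗ[K] V, π ∘ₗ ι = LinearMap.id ∧ (∀ x y, π (D.right x y) = 0) ∧
      ∀ x y, π (D.left x y) = 0 := by
  let e : ULift.{u} V ≃ₗ[K] V := ULift.moduleEquiv
  obtain ⟨g, ⟨⟨hgl, hgr⟩, hg⟩, -⟩ := hD _ (zeroDuplicial K (ULift.{u} V)) e.symm.toLinearMap
  refine ⟨e.toLinearMap ∘ₗ g, ?_, fun x y => ?_, fun x y => ?_⟩
  · rw [LinearMap.comp_assoc, hg, LinearEquiv.comp_symm]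
  · exact (congrArg e (hgr x y)).trans (map_zero e)
  · exact (congrArg e (hgl x y)).trans (map_zero e)

theorem nonempty_contraction (hD : IsFreeDuplicial D ι) {π : A →ₗ[K] V}
    (hπ : π ∘ₗ ι = LinearMap.id) (hπr : ∀ x y, π (D.right x y) = 0)
    (hπl : ∀ x y, π (D.left x y) = 0) : Nonempty (Contraction D ι π) := by
  obtain ⟨σ, hσι, hσl, hσr⟩ := hD.exists_splitRight
  obtain ⟨ρ, hρ⟩ : ∃ ρ : A →ₗ[K] A, ∀ x, ρ x = x - TensorProduct.lift D.right (σ x) :=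
    ⟨LinearMap.id - TensorProduct.lift D.right ∘ₗ σ, fun _ => rfl⟩
  have hρr (x y : A) : ρ (D.right x y) = 0 := by
    rw [hρ, hσr, map_add, lift_right_rTensor, TensorProduct.lift.tmul, ← map_add,
      add_sub_cancel, sub_self]
  have hρl (x y : A) : ρ (D.left x y) = D.left (ρ x) y := by
    rw [hρ, hσl, lift_right_lTensor, hρ, map_sub, LinearMap.sub_apply]
  obtain ⟨θ, hθι, hθl, hθr⟩ := hD.exists_splitLeft hρr hρl
  have hremainder : ρ - TensorProduct.lift D.left ∘ₗ θ = ι ∘ₗ π := by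
    refine hD.hom_ext_of_eq_zero (fun x y => ?_) (fun x y => ?_) (fun x y => ?_)
      (fun x y => ?_) (LinearMap.ext fun v => ?_)
    · rw [LinearMap.sub_apply, LinearMap.comp_apply, hρl, hθl, map_add, lift_left_lTensor,
        TensorProduct.lift.tmul, ← LinearMap.add_apply, ← map_add, add_sub_cancel, sub_self]
    · rw [LinearMap.sub_apply, LinearMap.comp_apply, hρr, hθr, map_zero, sub_zero]
    · rw [LinearMap.comp_apply, hπl, map_zero]
    · rw [LinearMap.comp_apply, hπr, map_zero]
    · simp only [LinearMap.comp_apply, LinearMap.sub_apply, hρ, hσι, hθι, map_zero, sub_zero]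
      exact congrArg ι (LinearMap.congr_fun hπ v).symm
  replace hremainder (x : A) : ρ x - TensorProduct.lift D.left (θ x) = ι (π x) :=
    LinearMap.congr_fun hremainder x
  exact ⟨{
    splitRight := σ
    splitLeft := θ
    decomp := fun x => by
      rw [← hremainder, hρ]
      abel
    splitRight_right := hσr
    splitRight_left := hσl
    splitLeft_right := hθr
    splitLeft_left := fun x y => by rw [hθl, hremainder]
    proj_right := hπr
    proj_left := hπl }⟩

end IsFreeDuplicial

/-! ### The operadic chain complex and the total complex -/

section Comparison

variable {K : Type u} [Field K] {A : Type w} [AddCommGroup A] [Module K A]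

variable (A) in
/-- The map `f ⊗ a ↦ f(x ≻ ⋯ ≻ x ≺ ⋯ ≺ x) a`, the monomial having `p` operations `≻` and `q`
operations `≺`. -/
def evalMon (p q : ℕ) {n : ℕ} (h : p + q + 1 = n) :
    Chains (dupRelators K) A n →ₗ[K] ⨂[K] _ : Fin n, A :=
  (TensorProduct.lid K _).toLinearMap ∘ₗ
    LinearMap.rTensor _ (Module.Dual.eval K _ (monOp K p q h))

theorem evalMon_tmul (p q : ℕ) {n : ℕ} (h : p + q + 1 = n)
    (f : Module.Dual K ((koszulDual (dupRelators K)).Op n)) (a : ⨂[K] _ : Fin n, A) :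
    evalMon A p q h (f ⊗ₜ[K] a) = f (monOp K p q h) • a := by
  simp [evalMon]

theorem sum_dupGen {M : Type*} [AddCommMonoid M] (f : DupGen → M) :
    ∑ e, f e = f .left + f .right := by
  rw [show (Finset.univ : Finset DupGen) = {DupGen.left, DupGen.right} from rfl,
    Finset.sum_pair (by decide)]

theorem evalMon_differential_tmul (D : DuplicialAlgebra K A) (p q : ℕ) {n : ℕ}
    (h : p + q + 1 = n) (f : Module.Dual K ((koszulDual (dupRelators K)).Op (n + 1)))
    (a : ⨂[K] _ : Fin (n + 1), A) :
    evalMon A p q h (differential (dupRelators K) D.op n (f ⊗ₜ[K] a)) =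
      ∑ i : Fin n, ∑ e : DupGen, (-1 : K) ^ (i : ℕ) •
        f (insertGenerator (dupRelators K) e i (monOp K p q h)) • face (D.op e) rfl i a := by
  simp only [differential, LinearMap.sum_apply, map_sum]
  refine Finset.sum_congr rfl fun i _ => Finset.sum_congr rfl fun e _ => ?_
  rw [LinearMap.smul_apply, map_smul, TensorProduct.map_tmul, evalMon_tmul]
  rfl

theorem evalMon_differential (D : DuplicialAlgebra K A) (p q : ℕ) {n : ℕ} (h : p + q + 1 = n)
    (x : Chains (dupRelators K) A (n + 1)) :
    evalMon A p q h (differential (dupRelators K) D.op n x) =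
      facesBelow D.right (p + 1) n (evalMon A (p + 1) q (by omega) x) +
        facesAbove D.left p n (evalMon A p (q + 1) (by omega) x) := by
  induction x using TensorProduct.induction_on with
  | zero => simp
  | add x y hx hy =>
    simp only [map_add, hx, hy]
    abel
  | tmul f a =>
    rw [evalMon_differential_tmul, facesBelow, facesAbove, LinearMap.sum_apply,
      LinearMap.sum_apply, ← Finset.sum_add_distrib]
    refine Finset.sum_congr rfl fun i _ => ?_
    rw [sum_dupGen, insertGenerator_left_monOp, insertGenerator_right_monOp, add_comm,
      evalMon_tmul, evalMon_tmul, map_smul, map_smul]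
    congr 1
    · simp only [Nat.lt_succ_iff]
      split_ifs
      · rw [LinearMap.smul_apply, smul_comm]
        rfl
      · rw [map_zero, zero_smul, smul_zero, LinearMap.zero_apply, smul_zero]
    · split_ifs
      · rw [LinearMap.smul_apply, smul_comm]
        rfl
      · rw [map_zero, zero_smul, smul_zero, LinearMap.zero_apply, smul_zero]

variable (K A) in
/-- The identification of operadic chains with families of tensors given by the basis of
monomials. -/
def chainEquiv (n : ℕ) :
    Chains (dupRelators K) A (n + 1) ≃ₗ[K] (Fin (n + 1) → ⨂[K] _ : Fin (n + 1), A) :=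
  TensorProduct.comm K _ _ ≪≫ₗ
    TensorProduct.congr (LinearEquiv.refl K _) (monBasis K n).dualBasis.equivFun ≪≫ₗ
    TensorProduct.piScalarRight K K _ (Fin (n + 1))

theorem chainEquiv_apply (n : ℕ) (x : Chains (dupRelators K) A (n + 1)) (p : Fin (n + 1)) :
    chainEquiv K A n x p = evalMon A p (n - p) (by omega) x := by
  induction x using TensorProduct.induction_on with
  | zero => simp
  | add x y hx hy => simp only [map_add, Pi.add_apply, hx, hy]
  | tmul f a => simp [chainEquiv, evalMon_tmul, monBasis_apply]

theorem evalMon_eq_chainEquiv {p q n : ℕ} (h : p + q + 1 = n + 1)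
    (x : Chains (dupRelators K) A (n + 1)) :
    evalMon A p q h x = chainEquiv K A n x ⟨p, by omega⟩ := by
  obtain rfl : q = n - p := by omega
  rw [chainEquiv_apply n x ⟨p, by omega⟩]

theorem totDiff_comp_chainEquiv (D : DuplicialAlgebra K A) (n : ℕ) :
    totDiff D n ∘ₗ chainEquiv K A (n + 1) =
      chainEquiv K A n ∘ₗ differential (dupRelators K) D.op (n + 1) := by
  refine LinearMap.ext fun x => funext fun p => ?_
  change totDiff D n (chainEquiv K A (n + 1) x) p =
    chainEquiv K A n (differential (dupRelators K) D.op (n + 1) x) p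
  rw [totDiff_apply, chainEquiv_apply n _ p, evalMon_differential]
  exact congrArg₂ (facesBelow D.right (p + 1) (n + 1) · + facesAbove D.left p (n + 1) ·)
    (evalMon_eq_chainEquiv _ x).symm (evalMon_eq_chainEquiv _ x).symm

theorem monOp_zero_zero : monOp K 0 0 rfl = (koszulDual (dupRelators K)).one :=
  treeClass_eq_one _ _ _

theorem augmentation_eq {V : Type v} [AddCommGroup V] [Module K V] (π : A →ₗ[K] V) :
    augmentation (dupRelators K) π = totAugmentation π ∘ₗ chainEquiv K A 0 := by
  refine TensorProduct.ext' fun f a => ?_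
  have h : chainEquiv K A 0 (f ⊗ₜ[K] a) 0 = f (koszulDual (dupRelators K)).one • a :=
    ((chainEquiv_apply 0 _ 0).trans (evalMon_tmul 0 0 rfl f a)).trans
      (congrArg (f · • a) monOp_zero_zero)
  rw [LinearMap.comp_apply, LinearEquiv.coe_coe, totAugmentation, LinearMap.comp_apply,
    LinearMap.comp_apply, LinearMap.proj_apply, h]
  simp [augmentation]

theorem Contraction.isAcyclic {V : Type v} [AddCommGroup V] [Module K V]
    {D : DuplicialAlgebra K A} {ι : V →ₗ[K] A} {π : A →ₗ[K] V} (c : Contraction D ι π)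
    (hπ : Function.Surjective π) : IsAcyclic (dupRelators K) D.op π where
  exact_of_pos n hn := by
    obtain ⟨n, rfl⟩ : ∃ m, n = m + 1 := ⟨n - 1, by omega⟩
    exact (Function.Exact.iff_of_ladder_linearEquiv (totDiff_comp_chainEquiv D (n + 1))
      (totDiff_comp_chainEquiv D n)).1 (c.exact_totDiff n)
  exact_one :=
    (Function.Exact.iff_of_ladder_linearEquiv (e₃ := LinearEquiv.refl K V)
      (totDiff_comp_chainEquiv D 0) (augmentation_eq π).symm).1 c.exact_totDiff_totAugmentation
  surjective := by
    rw [augmentation_eq]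
    have heval : Function.Surjective
        (LinearMap.proj 0 : (Fin 1 → ⨂[K] _ : Fin 1, A) →ₗ[K] ⨂[K] _ : Fin 1, A) :=
      Function.surjective_eval 0
    exact (hπ.comp ((PiTensorProduct.subsingletonEquiv (R := K) (s := fun _ : Fin 1 => A)
      (0 : Fin 1)).surjective.comp heval)).comp (chainEquiv K A 0).surjective

/-! ### The bicomplex -/

/-- The isomorphism of tensor powers induced by an equality of exponents. -/
abbrev tcast {m n : ℕ} (h : m = n) : (⨂[K] _ : Fin m, A) ≃ₗ[K] ⨂[K] _ : Fin n, A :=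
  PiTensorProduct.reindex K (fun _ : Fin m => A) (finCongr h)

theorem tcast_rfl {n : ℕ} (h : n = n) (x : ⨂[K] _ : Fin n, A) : tcast h x = x := by
  rw [tcast, finCongr_refl, PiTensorProduct.reindex_refl, LinearEquiv.refl_apply]

theorem tcast_tcast {l m n : ℕ} (h : l = m) (h' : m = n) (x : ⨂[K] _ : Fin l, A) :
    tcast h' (tcast h x) = tcast (h.trans h') x := by
  subst h h'
  rw [tcast_rfl, tcast_rfl]

theorem face_eq_face_tcast (μ : A →ₗ[K] A →ₗ[K] A) {m k : ℕ} (h : m = k + 1) (i : Fin k)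
    (x : ⨂[K] _ : Fin m, A) : face μ h i x = face μ rfl i (tcast h x) := by
  subst h
  rw [tcast_rfl]

theorem facesBelow_tcast (μ : A →ₗ[K] A →ₗ[K] A) (p : ℕ) {k l : ℕ} (h : k = l)
    (h' : k + 1 = l + 1) (x : ⨂[K] _ : Fin (k + 1), A) :
    facesBelow μ p l (tcast h' x) = tcast h (facesBelow μ p k x) := by
  subst h
  rw [tcast_rfl, tcast_rfl]

theorem facesAbove_tcast (μ : A →ₗ[K] A →ₗ[K] A) (p : ℕ) {k l : ℕ} (h : k = l)
    (h' : k + 1 = l + 1) (x : ⨂[K] _ : Fin (k + 1), A) :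
    facesAbove μ p l (tcast h' x) = tcast h (facesAbove μ p k x) := by
  subst h
  rw [tcast_rfl, tcast_rfl]

theorem dHor_apply (D : DuplicialAlgebra K A) (p q : ℕ) (x : Bi K A (p + 1) q) :
    dHor D p q x = facesBelow D.right (p + 1) (p + q + 1)
      (tcast (by omega : p + 1 + q + 1 = p + q + 1 + 1) x) := by
  simp only [dHor, facesBelow, LinearMap.sum_apply]
  refine Finset.sum_of_injOn (fun i : Fin (p + 1) => (⟨i, by omega⟩ : Fin (p + q + 1))) ?_ ?_ ?_ ?_
  · intro i _ j _ hij
    simpa [Fin.ext_iff] using hij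
  · intro i _
    exact Finset.mem_coe.2 (Finset.mem_univ _)
  · intro i _ hi
    rw [if_neg fun h => hi ⟨⟨i, h⟩, Finset.mem_coe.2 (Finset.mem_univ _), rfl⟩,
      LinearMap.zero_apply]
  · intro i _
    rw [if_pos i.2, LinearMap.smul_apply, LinearMap.smul_apply, face_eq_face_tcast]

theorem dVer_apply (D : DuplicialAlgebra K A) (p q : ℕ) (x : Bi K A p (q + 1)) :
    dVer D p q x = facesAbove D.left p (p + q + 1)
      (tcast (by omega : p + (q + 1) + 1 = p + q + 1 + 1) x) := by
  simp only [dVer, facesAbove, LinearMap.sum_apply]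
  refine Finset.sum_of_injOn (fun i : Fin (q + 1) => (⟨p + i, by omega⟩ : Fin (p + q + 1)))
    ?_ ?_ ?_ ?_
  · intro i _ j _ hij
    simpa [Fin.ext_iff] using hij
  · intro i _
    exact Finset.mem_coe.2 (Finset.mem_univ _)
  · intro i _ hi
    rw [if_neg, LinearMap.zero_apply]
    exact fun h => hi ⟨⟨i - p, by omega⟩, Finset.mem_coe.2 (Finset.mem_univ _),
      Fin.ext (Nat.add_sub_cancel' h)⟩
  · intro i _
    rw [if_pos (Nat.le_add_right p i), LinearMap.smul_apply, LinearMap.smul_apply,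
      face_eq_face_tcast]

theorem dHor_dHor (D : DuplicialAlgebra K A) (p q : ℕ) :
    dHor D p q ∘ₗ dHor D (p + 1) q = 0 := by
  refine LinearMap.ext fun x => ?_
  rw [LinearMap.comp_apply, dHor_apply, dHor_apply,
    ← facesBelow_tcast _ _ _ (by omega : p + 1 + q + 1 + 1 = p + q + 1 + 1 + 1)]
  exact LinearMap.congr_fun (facesBelow_facesBelow D.right_right (p + 1) (p + q + 1)) _

theorem dVer_dVer (D : DuplicialAlgebra K A) (p q : ℕ) :
    dVer D p q ∘ₗ dVer D p (q + 1) = 0 := by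
  refine LinearMap.ext fun x => ?_
  rw [LinearMap.comp_apply, dVer_apply, dVer_apply,
    ← facesAbove_tcast _ _ _ (by omega : p + (q + 1) + 1 + 1 = p + q + 1 + 1 + 1)]
  exact LinearMap.congr_fun (facesAbove_facesAbove D.left_left p (p + q + 1)) _

theorem dHor_dVer_add (D : DuplicialAlgebra K A) (p q : ℕ) :
    dHor D p q ∘ₗ dVer D (p + 1) q + dVer D p q ∘ₗ dHor D p (q + 1) = 0 := by
  refine LinearMap.ext fun x => ?_
  rw [LinearMap.add_apply, LinearMap.comp_apply, LinearMap.comp_apply, dHor_apply, dHor_apply,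
    dVer_apply, dVer_apply,
    ← facesBelow_tcast _ _ _ (by omega : p + (q + 1) + 1 + 1 = p + q + 1 + 1 + 1),
    ← facesAbove_tcast _ _ _ (by omega : p + 1 + q + 1 + 1 = p + q + 1 + 1 + 1),
    tcast_tcast, tcast_tcast]
  exact LinearMap.congr_fun (facesBelow_facesAbove D p (p + q + 1)) _

theorem toTot_apply (n : ℕ) (x : Chains (dupRelators K) A (n + 1))
    (s : {s : ℕ × ℕ // s.1 + s.2 = n}) :
    toTot n x s = tcast (congrArg (· + 1) s.2.symm)
      (evalMon A s.1.1 s.1.2 (congrArg (· + 1) s.2) x) := by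
  induction x using TensorProduct.induction_on with
  | zero => simp
  | add x y hx hy => simp only [map_add, Pi.add_apply, hx, hy]
  | tmul f a =>
    rw [evalMon_tmul, map_smul]
    rfl

variable (K A) in
/-- The identification of the families indexed by `p ≤ n` with the families indexed by the
bidegrees `(p, q)`, `p + q = n`. -/
def totEquiv (n : ℕ) : (Fin (n + 1) → ⨂[K] _ : Fin (n + 1), A) ≃ₗ[K] Tot K A n :=
  (LinearEquiv.funCongrLeft K _
    { toFun := fun s : {s : ℕ × ℕ // s.1 + s.2 = n} => (⟨s.1.1, by omega⟩ : Fin (n + 1))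
      invFun := fun p => ⟨(p, n - p), by omega⟩
      left_inv := fun s => Subtype.ext (Prod.ext rfl (by have := s.2; simp only; omega))
      right_inv := fun _ => rfl }) ≪≫ₗ
    LinearEquiv.piCongrRight fun s => tcast (congrArg (· + 1) s.2.symm)

theorem toTot_eq (n : ℕ) (x : Chains (dupRelators K) A (n + 1)) :
    toTot n x = totEquiv K A n (chainEquiv K A n x) := by
  funext s
  rw [toTot_apply, evalMon_eq_chainEquiv]
  rfl

theorem toTot_bijective (n : ℕ) : Function.Bijective (toTot (K := K) (A := A) n) := by
  rw [show ⇑(toTot n) = totEquiv K A n ∘ chainEquiv K A n from funext (toTot_eq n)]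
  exact (totEquiv K A n).bijective.comp (chainEquiv K A n).bijective

theorem dTot_toTot (D : DuplicialAlgebra K A) (n : ℕ) :
    dTot D n ∘ₗ toTot (n + 1) =
      toTot n ∘ₗ differential (dupRelators K) D.op (n + 1) := by
  refine LinearMap.ext fun x => funext fun s => ?_
  obtain ⟨⟨p, q⟩, h⟩ := s
  obtain rfl : p + q = n := h
  rw [LinearMap.comp_apply, LinearMap.comp_apply, toTot_apply, tcast_rfl, evalMon_differential]
  change dHor D p q (toTot (p + q + 1) x ⟨(p + 1, q), by simp only; omega⟩) +
    dVer D p q (toTot (p + q + 1) x ⟨(p, q + 1), rfl⟩) = _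
  rw [dHor_apply, dVer_apply, toTot_apply, toTot_apply, tcast_tcast, tcast_tcast, tcast_rfl,
    tcast_rfl]

end Comparison

/-! ### The operad of duplicial algebras is a Koszul operad -/

section DupKoszul

variable {K : Type u} [Field K] {D : DuplicialAlgebra K (TotalSpace (dupRelators K))}

theorem isFreeDuplicial_of_op_eq_totalProduct (hD : D.op = totalProduct (dupRelators K)) :
    IsFreeDuplicial D (DirectSum.lof K ℕ (fun n => (quadraticOperad (dupRelators K)).Op n) 1) := by
  intro B _ _ D' f
  have hB : IsAlgebraOfType (dupRelators K) D'.op := isAlgebraOfType_dupRelators_iff.2 ⟨D', rfl⟩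
  have hg (b : B) (e : DupGen) (x y : TotalSpace (dupRelators K)) :
      totalLift hB b (D.op e x y) = D'.op e (totalLift hB b x) (totalLift hB b y) := by
    rw [hD, totalLift_totalProduct]
  refine ⟨totalLift hB (f (quadraticOperad (dupRelators K)).one),
    ⟨⟨hg _ .left, hg _ .right⟩, op_hom_ext fun t ht => ?_⟩, ?_⟩
  · rw [LinearMap.comp_apply, lof_treeClass, totalLift_totalClass, treeClass_eq_one]
    obtain rfl := PTree.eq_of_leaves_eq_one ht
    rfl
  · rintro g ⟨⟨hl, hr⟩, rfl⟩
    refine eq_totalLift hB (fun e x y => ?_) rfl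
    rw [← hD]
    cases e
    · exact hl x y
    · exact hr x y

variable (K) in
theorem isKoszul_dupRelators : IsKoszul (dupRelators K) := by
  obtain ⟨D, hD⟩ := isAlgebraOfType_dupRelators_iff.1 (isAlgebraOfType_totalProduct (dupRelators K))
  have hcomp (e : DupGen) (x y : TotalSpace (dupRelators K)) :
      DirectSum.component K ℕ (fun n => (quadraticOperad (dupRelators K)).Op n) 1
        (D.op e x y) = 0 := by
    rw [hD, component_one_totalProduct]
  have hι : DirectSum.component K ℕ (fun n => (quadraticOperad (dupRelators K)).Op n) 1 ∘ₗ
      DirectSum.lof K ℕ (fun n => (quadraticOperad (dupRelators K)).Op n) 1 = LinearMap.id :=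
    LinearMap.ext fun x => DirectSum.component.lof_self K 1 x
  obtain ⟨c⟩ := IsFreeDuplicial.nonempty_contraction.{u, u}
    (isFreeDuplicial_of_op_eq_totalProduct hD) hι (hcomp .right) (hcomp .left)
  rw [IsKoszul, ← hD]
  exact c.isAcyclic fun x => ⟨DirectSum.lof K ℕ _ 1 x, LinearMap.congr_fun hι x⟩

end DupKoszul

end NSKoszul

end

theorem theorem5p4 (K : Type u) [Field K] :
    -- the operad of duplicial algebras is a Koszul operad
    NSKoszul.IsKoszul (NSKoszul.dupRelators K) ∧
    -- its Koszul dual is presented by the duplicial relators and the two additional ones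
    NSKoszul.orthogonal (NSKoszul.dupRelators K) =
      NSKoszul.dupRelators K ⊔ NSKoszul.dupExtraRelators K ∧
    -- that is, algebras over the dual are duplicial algebras with `(x ≺ y) ≻ z = 0 = x ≺ (y ≻ z)`
    (∀ (A : Type w) [AddCommGroup A] [Module K A] (op : NSKoszul.DupGen → A →ₗ[K] A →ₗ[K] A),
      NSKoszul.IsAlgebraOfType (NSKoszul.orthogonal (NSKoszul.dupRelators K)) op ↔
        ∃ D : NSKoszul.DuplicialAlgebra K A, D.op = op ∧
          (∀ x y z : A, D.right (D.left x y) z = 0) ∧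
          (∀ x y z : A, D.left x (D.right y z) = 0)) ∧
    -- the operadic chain complex of a duplicial algebra is the total complex of a bicomplex
    (∀ (A : Type w) [AddCommGroup A] [Module K A] (D : NSKoszul.DuplicialAlgebra K A),
      (∀ p q : ℕ, NSKoszul.dHor D p q ∘ₗ NSKoszul.dHor D (p + 1) q = 0) ∧
      (∀ p q : ℕ, NSKoszul.dVer D p q ∘ₗ NSKoszul.dVer D p (q + 1) = 0) ∧
      (∀ p q : ℕ, NSKoszul.dHor D p q ∘ₗ NSKoszul.dVer D (p + 1) q +
        NSKoszul.dVer D p q ∘ₗ NSKoszul.dHor D p (q + 1) = 0) ∧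
      (∀ n : ℕ, Function.Bijective (NSKoszul.toTot (K := K) (A := A) n)) ∧
      (∀ n : ℕ, NSKoszul.dTot D n ∘ₗ NSKoszul.toTot (n + 1) =
        NSKoszul.toTot n ∘ₗ
          NSKoszul.differential (NSKoszul.dupRelators K) D.op (n + 1))) ∧
    -- the operadic chain complex of a free duplicial algebra on `V` is acyclic: its homology is `V`
    -- in degree `1` and zero in degrees at least `2`
    (∀ (V : Type v) [AddCommGroup V] [Module K V] (A : Type (max u v)) [AddCommGroup A]
      [Module K A] (D : NSKoszul.DuplicialAlgebra K A) (ι : V →ₗ[K] A),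
      NSKoszul.IsFreeDuplicial D ι →
        ∃ π : A →ₗ[K] V, π ∘ₗ ι = LinearMap.id ∧
          NSKoszul.IsAcyclic (NSKoszul.dupRelators K) D.op π) := by
  refine ⟨NSKoszul.isKoszul_dupRelators K, NSKoszul.orthogonal_dupRelators,
    fun A _ _ op => NSKoszul.isAlgebraOfType_orthogonal_dupRelators_iff,
    fun A _ _ D => ⟨NSKoszul.dHor_dHor D, NSKoszul.dVer_dVer D, NSKoszul.dHor_dVer_add D,
      NSKoszul.toTot_bijective, NSKoszul.dTot_toTot D⟩, fun V _ _ A _ _ D ι hD => ?_⟩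
  obtain ⟨π, hπ, hr, hl⟩ := hD.exists_proj
  obtain ⟨c⟩ := hD.nonempty_contraction hπ hr hl
  exact ⟨π, hπ, c.isAcyclic fun v => ⟨ι v, LinearMap.congr_fun hπ v⟩⟩
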